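/- Let $\mathbb K$ be a field of characteristic $0$. Permutations of all sizes $n\ge 0$ are written as words; $\mathrm{std}(w)$ denotes the standardization of a word $w$. Let $\mathbf{FQSym}$ be the Hopf algebra of free quasi-symmetric functions over $\mathbb K$: it has a linear basis $(\mathbf G_\sigma)$ indexed by all permutations, unit $\mathbf G_\emptyset$, and product $$\mathbf G_\alpha\mathbf G_\beta=\sum_{\gamma=u\cdot v,\ \mathrm{std}(u)=\alpha,\ \mathrm{std}(v)=\beta}\mathbf G_\gamma ,$$ and, with $\mathbf F_\sigma=\mathbf G_{\sigma^{-1}}$, coproduct $\Delta\mathbf F_\sigma=\sum_{\sigma=u\cdot v}\mathbf F_{\mathrm{std}(u)}\otimes\mathbf F_{\mathrm{std}(v)}$. The pairing is $\langle\mathbf F_\sigma,\mathbf G_\tau\rangle=\delta_{\sigma,\tau}$. Let $\le$ be the left weak order on $\mathfrak S_n$ ($\tau\le\sigma$ iff every pair of positions $i<j$ with $\tau(i)>\tau(j)$ satisfies $\sigma(i)>\sigma(j)$), with Möbius function $\mu$, and let $$\mathbf M_\sigma=\sum_{\tau\ge\sigma}\mu(\sigma,\tau)\,\mathbf F_\tau$$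 be the free monomial functions of Aguiar and Sottile. A permutation $\sigma$ of size $n\ge1$ is connected if no $k$ with $0<k<n$ satisfies $\sigma(\{1,\dots,k\})=\{1,\dots,k\}$, and anticonnected if its mirror image $\sigma(n)\cdots\sigma(1)$ is connected. Every permutation decomposes as $\sigma=\sigma_1\triangleleft\cdots\triangleleft\sigma_r$ into anticonnected components, where $u\triangleleft v$ is the concatenation of $u$, with its letters shifted by the length of $v$, and $v$. Put $\mathbf S^\sigma=\mathbf S^{\sigma_1}\cdots\mathbf S^{\sigma_r}$, where $\mathbf S^{\sigma}=\sum_{\tau\le\sigma}\mathbf G_\tau$ for $\sigma$ anticonnected. Then $(\mathbf M_\sigma)$ is adjoint to $(\mathbf S^\sigma)$, that is, $\langle\mathbf M_\sigma,\mathbf S^\tau\rangle=\delta_{\sigma,\tau}$ for all permutations $\sigma,\tau$. The primitive elements of $\mathbf{FQSym}$ (those $x$ with $\Delta x=x\otimes1+1\otimes x$) form a Lie subalgebra for the bracket $[x,y]=xy-yx$, and the family $(\mathbf M_\sigma)$, with $\sigma$ ranging over the anticonnected permutations, is a linear basis of this Lie algebra. -/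

import Mathlib

open scoped TensorProduct

noncomputable section

namespace FQS

/-! ### Permutations and words -/

/-- A permutation of some finite set `{0, …, n - 1}` (so the letters are numbered from `0`);
`σ.1` is the size `n`, and the empty permutation is included. -/
abbrev Permu : Type := Σ n : ℕ, Equiv.Perm (Fin n)

/-- The empty permutation. -/
def emptyPermu : Permu := ⟨0, 1⟩

/-- The one-line word `σ(0) σ(1) ⋯ σ(n - 1)` of a permutation. -/
def word (σ : Permu) : List ℕ := List.ofFn fun i => (σ.2 i : ℕ)

/-- The inverse permutation. -/
def inv (σ : Permu) : Permu := ⟨σ.1, σ.2⁻¹⟩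

theorem inv_inv' (σ : Permu) : inv (inv σ) = σ := by
  obtain ⟨n, σ⟩ := σ
  exact congrArg (Sigma.mk n) (inv_inv σ)

/-- Inversion as a bijection of the set of permutations. -/
def invEquiv : Permu ≃ Permu where
  toFun := inv
  invFun := inv
  left_inv σ := inv_inv' σ
  right_inv σ := inv_inv' σ

/-- The mirror image `σ(n - 1) ⋯ σ(1) σ(0)`. -/
def mirror (σ : Permu) : Permu := ⟨σ.1, Fin.revPerm.trans σ.2⟩

/-- The standardization of a word: the permutation having the same inversions as `w`.
`Tuple.sort` is the stable sorting permutation (equal letters are ordered from left to right). -/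
def std (w : List ℕ) : Permu := ⟨w.length, (Tuple.sort w.get)⁻¹⟩

/-- The standardized prefix of length `k`. -/
def pre (σ : Permu) (k : ℕ) : Permu := std ((word σ).take k)

/-- The standardized suffix that remains when the prefix of length `k` is deleted. -/
def suf (σ : Permu) (k : ℕ) : Permu := std ((word σ).drop k)

/-- Connected permutations: nonempty, with no proper nonempty prefix `σ(0) ⋯ σ(k - 1)` that is a
permutation of `{0, …, k - 1}`. -/
def IsConnected (σ : Permu) : Prop :=
  0 < σ.1 ∧ ∀ k, 0 < k → k < σ.1 → ¬ ∀ i : Fin σ.1, (i : ℕ) < k → (σ.2 i : ℕ) < k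

/-- Anticonnected permutations: the mirror image is connected. -/
def IsAnticonnected (σ : Permu) : Prop := IsConnected (mirror σ)

/-- Left-shifted concatenation: the letters of `σ` are shifted by the size of `τ`. -/
def lconcat (σ τ : Permu) : Permu := std ((word σ).map (· + τ.1) ++ word τ)

/-- The iterated left-shifted concatenation of a list of permutations. -/
def lconcatList (l : List Permu) : Permu := l.foldr lconcat emptyPermu

/-! ### The left weak order -/

/-- Permutations of `Fin n`, to be ordered by the left weak order. -/
def LeftWeak (n : ℕ) : Type := Equiv.Perm (Fin n)

instance (n : ℕ) : Fintype (LeftWeak n) := inferInstanceAs (Fintype (Equiv.Perm (Fin n)))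

instance (n : ℕ) : DecidableEq (LeftWeak n) := inferInstanceAs (DecidableEq (Equiv.Perm (Fin n)))

/-- A permutation is determined by its inversions. -/
theorem eq_of_inversions {n : ℕ} (σ τ : Equiv.Perm (Fin n))
    (h : ∀ i j, i < j → (σ j < σ i ↔ τ j < τ i)) : σ = τ := by
  have key : ∀ i j, σ i ≤ σ j → τ i ≤ τ j := by
    intro i j hij
    rcases lt_trichotomy i j with hlt | rfl | hlt
    · exact not_lt.1 fun hc => absurd ((h i j hlt).2 hc) (not_lt.2 hij)
    · exact le_rfl
    · have hne : σ i ≠ σ j := fun e => hlt.ne' (σ.injective e)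
      exact ((h j i hlt).1 (lt_of_le_of_ne hij hne)).le
  have hmono : Monotone (σ⁻¹.trans τ) := by
    intro a b hab
    simpa using key (σ⁻¹ a) (σ⁻¹ b) (by simpa using hab)
  have := (Equiv.Perm.monotone_iff _).1 hmono
  ext i
  have h2 := congrArg (fun e : Equiv.Perm (Fin n) => e (σ i)) this
  simpa using (congrArg Fin.val h2).symm

/-- The left weak order (left permutohedron): inclusion of the sets of inversions
`{(i, j) | i < j, σ(j) < σ(i)}`. -/
instance (n : ℕ) : PartialOrder (LeftWeak n) where
  le σ τ := ∀ i j : Fin n, i < j →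
    (show Equiv.Perm (Fin n) from σ) j < (show Equiv.Perm (Fin n) from σ) i →
    (show Equiv.Perm (Fin n) from τ) j < (show Equiv.Perm (Fin n) from τ) i
  le_refl _ _ _ _ h := h
  le_trans _ _ _ h₁ h₂ i j hij h := h₂ i j hij (h₁ i j hij h)
  le_antisymm σ τ h₁ h₂ := eq_of_inversions σ τ fun i j hij => ⟨h₁ i j hij, h₂ i j hij⟩

instance (n : ℕ) : DecidableLE (LeftWeak n) := Classical.decRel _

instance (n : ℕ) : DecidableLT (LeftWeak n) := Classical.decRel _

instance (n : ℕ) : LocallyFiniteOrder (LeftWeak n) := Fintype.toLocallyFiniteOrder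

/-! ### The vector space of free quasi-symmetric functions -/

/-- The space of free quasi-symmetric functions: the vector space with basis `(G_σ)`, where `σ`
ranges over all permutations. -/
def FQSym (K : Type*) [Field K] : Type _ := Permu →₀ K

variable (K : Type*) [Field K]

instance : AddCommGroup (FQSym K) := inferInstanceAs (AddCommGroup (Permu →₀ K))

instance : Module K (FQSym K) := inferInstanceAs (Module K (Permu →₀ K))

/-- The basis `(G_σ)`. -/
def gBasis : Module.Basis Permu K (FQSym K) := ⟨LinearEquiv.refl K (Permu →₀ K)⟩

/-- The basis `(F_σ)`, where `F_σ = G_{σ⁻¹}`. -/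
def fBasis : Module.Basis Permu K (FQSym K) := (gBasis K).reindex invEquiv

theorem fBasis_apply (σ : Permu) : fBasis K σ = gBasis K (inv σ) := by
  simp [fBasis, invEquiv]

/-! ### The product -/

/-- `G_α G_β` is the sum of the `G_γ` over the `γ = u · v` with `std u = α` and `std v = β`
(convolution of permutations). -/
def conv (α β : Permu) : FQSym K :=
  ∑ γ : Equiv.Perm (Fin (α.1 + β.1)),
    if pre ⟨_, γ⟩ α.1 = α ∧ suf ⟨_, γ⟩ α.1 = β then gBasis K ⟨_, γ⟩ else 0

/-- The product, as a bilinear map. -/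
def mulLin : FQSym K →ₗ[K] FQSym K →ₗ[K] FQSym K :=
  (gBasis K).constr K fun α => (gBasis K).constr K fun β => conv K α β

instance : Mul (FQSym K) := ⟨fun x y => mulLin K x y⟩

instance : One (FQSym K) := ⟨gBasis K emptyPermu⟩

theorem mul_def (x y : FQSym K) : x * y = mulLin K x y := rfl

theorem one_def : (1 : FQSym K) = gBasis K emptyPermu := rfl

theorem gBasis_mul (α β : Permu) : gBasis K α * gBasis K β = conv K α β := by
  simp [mul_def, mulLin]

theorem sort_congr {n : ℕ} (f g : Fin n → ℕ)
    (H : ∀ i j, i < j → (f i ≤ f j ↔ g i ≤ g j)) : Tuple.sort f = Tuple.sort g := by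
  symm
  have hg := (Tuple.eq_sort_iff (f := g) (σ := Tuple.sort g)).1 rfl
  generalize Tuple.sort g = σ at hg ⊢
  rw [Tuple.eq_sort_iff]
  obtain ⟨h1, h2⟩ := hg
  constructor
  · intro a b hab
    rcases hab.eq_or_lt with rfl | hlt
    · exact le_rfl
    rcases lt_trichotomy (σ a) (σ b) with h | h | h
    · exact (H _ _ h).2 (h1 hab)
    · exact absurd (σ.injective h) hlt.ne
    · by_contra hc
      have := (H _ _ h).1 (not_le.1 hc).le
      exact absurd (h2 a b hlt (le_antisymm (h1 hab) this)) h.asymm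
  · intro a b hlt hab
    rcases lt_trichotomy (σ a) (σ b) with h | h | h
    · exact h
    · exact absurd (σ.injective h) hlt.ne
    · exact h2 a b hlt (le_antisymm (h1 hlt.le) ((H _ _ h).1 hab.ge))

theorem std_congr {u v : List ℕ} (hl : u.length = v.length)
    (H : ∀ i j (hi : i < u.length) (hj : j < u.length), i < j →
      (u[i] ≤ u[j] ↔ v[i] ≤ v[j])) : std u = std v := by
  obtain ⟨n, f, rfl⟩ : ∃ n, ∃ f : Fin n → ℕ, u = List.ofFn f := ⟨_, _, (List.ofFn_get u).symm⟩
  obtain ⟨m, g, rfl⟩ : ∃ n, ∃ f : Fin n → ℕ, v = List.ofFn f := ⟨_, _, (List.ofFn_get v).symm⟩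
  obtain rfl : n = m := by simpa using hl
  have h := sort_congr f g fun i j hij => by
    simpa using H i j (by simp) (by simp) hij
  have e : ∀ f : Fin n → ℕ, std (List.ofFn f) = ⟨n, (Tuple.sort f)⁻¹⟩ := by
    intro f
    have : ∀ (w : List ℕ) (hw : w.length = n),
        std w = ⟨n, (Tuple.sort fun i : Fin n => w.get (i.cast hw.symm))⁻¹⟩ := by
      rintro w rfl; rfl
    rw [this _ (List.length_ofFn)]
    simp
  rw [e, e, h]

@[simp] theorem length_word (σ : Permu) : (word σ).length = σ.1 := by simp [word]

theorem word_std_le (w : List ℕ) (i j : ℕ) (hi : i < w.length) (hj : j < w.length)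
    (hij : i < j) :
    ((word (std w))[i]'(by simpa [std] using hi) ≤ (word (std w))[j]'(by simpa [std] using hj)) ↔
      w[i] ≤ w[j] := by
  have hg := (Tuple.eq_sort_iff (f := w.get) (σ := Tuple.sort w.get)).1 rfl
  simp only [word, std, List.getElem_ofFn, Fin.val_fin_le]
  suffices H : ∀ σ : Equiv.Perm (Fin w.length), (Monotone (w.get ∘ σ) ∧
      ∀ i j, i < j → w.get (σ i) = w.get (σ j) → σ i < σ j) →
      (σ⁻¹ ⟨i, hi⟩ ≤ σ⁻¹ ⟨j, hj⟩ ↔ w[i] ≤ w[j]) from H _ hg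
  intro σ hg
  obtain ⟨h1, h2⟩ := hg
  obtain ⟨a, ha⟩ := σ.surjective ⟨i, hi⟩
  obtain ⟨b, hb⟩ := σ.surjective ⟨j, hj⟩
  have e1 : w[i] = w.get (σ a) := by simp [ha]
  have e2 : w[j] = w.get (σ b) := by simp [hb]
  rw [e1, e2, ← ha, ← hb]
  have e3 : ∀ c, σ⁻¹ (σ c) = c := fun c => σ.symm_apply_apply c
  rw [e3, e3]
  have hlt : σ a < σ b := by rw [ha, hb]; exact hij
  constructor
  · exact fun h => h1 h
  · intro h
    by_contra hc
    have hba := not_le.1 hc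
    exact absurd (h2 b a hba (le_antisymm (h1 hba.le) h)) hlt.asymm

theorem std_take (w : List ℕ) (k : ℕ) : std ((word (std w)).take k) = std (w.take k) := by
  refine std_congr ?_ ?_
  · simp [std]
  · intro i j hi hj hij
    simp only [List.getElem_take]
    simp only [List.length_take, length_word, lt_min_iff] at hi hj
    exact word_std_le w i j hi.2 hj.2 hij

theorem std_drop (w : List ℕ) (k : ℕ) : std ((word (std w)).drop k) = std (w.drop k) := by
  refine std_congr ?_ ?_
  · simp [std]
  · intro i j hi hj hij
    simp only [List.getElem_drop]
    simp only [List.length_drop, length_word] at hi hj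
    have hs : (std w).1 = w.length := rfl
    exact word_std_le w (k + i) (k + j) (by omega) (by omega) (by omega)

theorem word_injective : Function.Injective word := by
  rintro ⟨n, σ⟩ ⟨m, τ⟩ h
  obtain rfl : n = m := by simpa using congrArg List.length h
  have := List.ofFn_injective h
  congr
  ext i
  exact congrFun this i

theorem std_word (σ : Permu) : std (word σ) = σ := by
  have hl : (std (word σ)).1 = σ.1 := by simp [std]
  have H := fun i j hi hj hij => word_std_le (word σ) i j hi hj hij
  suffices H' : ∀ τ : Permu, (hl : τ.1 = σ.1) → (∀ i j (hi : i < (word σ).length)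
      (hj : j < (word σ).length), i < j →
      ((word τ)[i]'(by simpa [hl] using hi) ≤ (word τ)[j]'(by simpa [hl] using hj) ↔
        (word σ)[i] ≤ (word σ)[j])) → τ = σ from H' _ hl H
  clear hl H
  intro τ hl H
  obtain ⟨n, τ⟩ := τ
  obtain ⟨m, σ⟩ := σ
  obtain rfl : n = m := hl
  congr
  apply eq_of_inversions
  intro i j hij
  have := H i j (by simp) (by simp) hij
  simp only [word, List.getElem_ofFn, Fin.val_fin_le] at this
  rw [← not_le, ← not_le]
  exact not_congr this

theorem pre_fst (σ : Permu) (k : ℕ) : (pre σ k).1 = min k σ.1 := by simp [pre, std]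

theorem suf_fst (σ : Permu) (k : ℕ) : (suf σ k).1 = σ.1 - k := by simp [suf, std]

theorem pre_pre (σ : Permu) (k j : ℕ) : pre (pre σ k) j = pre σ (min j k) := by
  simp only [pre, std_take, List.take_take]

theorem suf_suf (σ : Permu) (k j : ℕ) : suf (suf σ k) j = suf σ (k + j) := by
  simp only [suf, std_drop, List.drop_drop]

theorem suf_pre (σ : Permu) (k j : ℕ) : suf (pre σ (k + j)) k = pre (suf σ k) j := by
  simp only [pre, suf, std_take, std_drop, List.drop_take]
  simp

/-- The coordinate of `x` on `G_γ`. -/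
def coeff (γ : Permu) : FQSym K →ₗ[K] K := (gBasis K).coord γ

theorem ext_coeff {x y : FQSym K} (h : ∀ γ, coeff K γ x = coeff K γ y) : x = y :=
  (gBasis K).ext_elem h

open Classical in
theorem coeff_gBasis (γ α : Permu) : coeff K γ (gBasis K α) = if α = γ then 1 else 0 := by
  simp [coeff, Finsupp.single_apply]

open Classical in
theorem coeff_conv (α β γ : Permu) : coeff K γ (conv K α β) =
    if γ.1 = α.1 + β.1 ∧ pre γ α.1 = α ∧ suf γ α.1 = β then 1 else 0 := by
  rw [conv, map_sum]
  simp only [apply_ite (coeff K γ), coeff_gBasis, map_zero]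
  by_cases h : γ.1 = α.1 + β.1
  · obtain ⟨n, γ⟩ := γ
    obtain rfl : n = α.1 + β.1 := h
    rw [Finset.sum_eq_single γ]
    · simp
    · intro b _ hb
      have : (⟨_, b⟩ : Permu) ≠ ⟨_, γ⟩ := fun e => hb (by simpa using e)
      simp [this]
    · simp
  · rw [if_neg (fun hc => h hc.1)]
    refine Finset.sum_eq_zero fun b _ => ?_
    have : (⟨_, b⟩ : Permu) ≠ γ := fun e => h (by rw [← e])
    simp [this]

/-- The coefficients of a product. -/
theorem coeff_mul (γ : Permu) (x y : FQSym K) : coeff K γ (x * y) =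
    ∑ k ∈ Finset.range (γ.1 + 1), coeff K (pre γ k) x * coeff K (suf γ k) y := by
  classical
  let B : FQSym K →ₗ[K] FQSym K →ₗ[K] K :=
    ∑ k ∈ Finset.range (γ.1 + 1),
      (LinearMap.mul K K).compl₁₂ (coeff K (pre γ k)) (coeff K (suf γ k))
  have hB : (mulLin K).compr₂ (coeff K γ) = B := by
    refine (gBasis K).ext fun α => (gBasis K).ext fun β => ?_
    have h1 : (mulLin K).compr₂ (coeff K γ) (gBasis K α) (gBasis K β)
        = coeff K γ (conv K α β) := by
      rw [← gBasis_mul]; rfl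
    rw [h1, coeff_conv]
    simp only [B, LinearMap.sum_apply, LinearMap.compl₁₂_apply, LinearMap.mul_apply', coeff_gBasis]
    by_cases h : γ.1 = α.1 + β.1 ∧ pre γ α.1 = α ∧ suf γ α.1 = β
    · rw [if_pos h, Finset.sum_eq_single α.1]
      · simp [h.2.1, h.2.2]
      · intro k hk hne
        have : α ≠ pre γ k := by
          intro e
          have := congrArg Sigma.fst e
          rw [pre_fst] at this
          simp only [Finset.mem_range] at hk
          omega
        simp [this]
      · intro hc; simp only [Finset.mem_range] at hc; omega
    · rw [if_neg h]
      symm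
      refine Finset.sum_eq_zero fun k hk => ?_
      by_contra hc
      have h1 : α = pre γ k := by by_contra e; simp [e] at hc
      have h2 : β = suf γ k := by by_contra e; simp [e] at hc
      simp only [Finset.mem_range] at hk
      have h3 : α.1 = k := by rw [h1, pre_fst]; omega
      have h4 : β.1 = γ.1 - k := by rw [h2, suf_fst]
      exact h ⟨by omega, by rw [h3, ← h1], by rw [h3, ← h2]⟩
  have := congrArg (fun L : FQSym K →ₗ[K] FQSym K →ₗ[K] K => L x y) hB
  rw [mul_def]
  simpa [B] using this

theorem fst_eq_zero {σ : Permu} (h : σ.1 = 0) : σ = emptyPermu := by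
  obtain ⟨n, σ⟩ := σ
  obtain rfl : n = 0 := h
  congr
  exact Subsingleton.elim _ _

theorem coeff_one (γ : Permu) : coeff K γ 1 = if γ.1 = 0 then 1 else 0 := by
  classical
  rw [one_def, coeff_gBasis]
  refine if_congr ⟨fun h => by rw [← h]; rfl, fun h => (fst_eq_zero h).symm⟩ rfl rfl

theorem pre_self (γ : Permu) : pre γ γ.1 = γ := by
  rw [pre, List.take_of_length_le (by simp), std_word]

theorem suf_zero (γ : Permu) : suf γ 0 = γ := by rw [suf, List.drop_zero, std_word]

theorem one_mul' (x : FQSym K) : 1 * x = x := by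
  refine ext_coeff K fun γ => ?_
  rw [coeff_mul, Finset.sum_eq_single 0]
  · simp [coeff_one, pre_fst, suf_zero]
  · intro k hk hne
    simp only [Finset.mem_range] at hk
    rw [coeff_one, pre_fst, if_neg (by omega), zero_mul]
  · simp

theorem mul_one' (x : FQSym K) : x * 1 = x := by
  refine ext_coeff K fun γ => ?_
  rw [coeff_mul, Finset.sum_eq_single γ.1]
  · simp [coeff_one, suf_fst, pre_self]
  · intro k hk hne
    simp only [Finset.mem_range] at hk
    rw [coeff_one, suf_fst, if_neg (by omega), mul_zero]
  · simp

theorem mul_assoc' (x y z : FQSym K) : x * y * z = x * (y * z) := by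
  refine ext_coeff K fun γ => ?_
  simp only [coeff_mul, Finset.sum_mul, Finset.mul_sum, Finset.sum_sigma']
  refine Finset.sum_bij' (fun p _ => ⟨p.2, p.1 - p.2⟩) (fun p _ => ⟨p.1 + p.2, p.1⟩) ?_ ?_ ?_ ?_ ?_
  · rintro ⟨k, j⟩ h
    simp only [Finset.mem_sigma, Finset.mem_range, pre_fst, suf_fst] at h ⊢
    omega
  · rintro ⟨k, j⟩ h
    simp only [Finset.mem_sigma, Finset.mem_range, pre_fst, suf_fst] at h ⊢
    omega
  · rintro ⟨k, j⟩ h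
    simp only [Finset.mem_sigma, Finset.mem_range, pre_fst] at h
    have : j + (k - j) = k := by omega
    simp [this]
  · rintro ⟨k, j⟩ h
    simp
  · rintro ⟨k, j⟩ h
    simp only [Finset.mem_sigma, Finset.mem_range, pre_fst] at h
    obtain ⟨d, rfl⟩ : ∃ d, k = j + d := ⟨k - j, by omega⟩
    simp only [pre_pre, suf_pre, suf_suf, Nat.add_sub_cancel_left, mul_assoc]
    simp

instance : Ring (FQSym K) where
  __ := (inferInstance : AddCommGroup (FQSym K))
  __ := (inferInstance : Mul (FQSym K))
  __ := (inferInstance : One (FQSym K))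
  left_distrib x y z := (mulLin K x).map_add y z
  right_distrib x y z := by simp [mul_def]
  zero_mul x := by simp [mul_def]
  mul_zero x := (mulLin K x).map_zero
  mul_assoc := mul_assoc' K
  one_mul := one_mul' K
  mul_one := mul_one' K

instance : Algebra K (FQSym K) :=
  Algebra.ofModule (fun r x y => by simp [mul_def]) (fun r x y => (mulLin K x).map_smul r y)

/-- The Lie bracket is the commutator `x * y - y * x`. -/
instance : LieRing (FQSym K) := LieRing.ofAssociativeRing

instance : LieAlgebra K (FQSym K) := LieAlgebra.ofAssociativeAlgebra

/-! ### Decomposition into anticonnected components -/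

/-- All the letters in the first `k` positions are larger than all the remaining ones. -/
def IsCut (σ : Permu) (k : ℕ) : Prop :=
  ∀ i j : Fin σ.1, (i : ℕ) < k → k ≤ (j : ℕ) → σ.2 j < σ.2 i

theorem lconcat_eq (σ : Permu) (k : ℕ) (hk : k ≤ σ.1) (h : IsCut σ k) :
    lconcat (pre σ k) (suf σ k) = σ := by
  rw [lconcat, ← std_word σ]
  have hw1 : (word (pre σ k)).length = k := by rw [length_word, pre_fst]; omega
  have hw2 : (word (suf σ k)).length = σ.1 - k := by rw [length_word, suf_fst]
  conv_lhs => rw [std_word σ]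
  have hb : ∀ (ρ : Permu) (i : ℕ) (hi : i < (word ρ).length), (word ρ)[i] < ρ.1 := by
    intro ρ i hi
    simp [word]
  refine std_congr ?_ ?_
  · simp only [List.length_append, List.length_map, hw1, hw2, length_word]; omega
  · intro i j hi hj hij
    simp only [List.length_append, List.length_map, hw1, hw2] at hi hj
    rcases lt_or_ge j k with hjk | hjk
    · rw [List.getElem_append_left (by simp [hw1]; omega),
        List.getElem_append_left (by simp [hw1]; omega)]
      simp only [List.getElem_map, Nat.add_le_add_iff_right]
      have := word_std_le ((word σ).take k) i j (by simp; omega) (by simp; omega) hij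
      simpa [pre] using this
    · rcases lt_or_ge i k with hik | hik
      · rw [List.getElem_append_left (by simp [hw1]; omega),
          List.getElem_append_right (by simp [hw1]; omega)]
        simp only [List.getElem_map, List.length_map]
        have h1 := hb (suf σ k) (j - (word (pre σ k)).length) (by rw [hw1, hw2]; omega)
        have h2 : (word σ)[j]'(by simp; omega) < (word σ)[i]'(by simp; omega) := by
          have := h ⟨i, by omega⟩ ⟨j, by omega⟩ hik hjk
          simpa [word] using this
        omega
      · rw [List.getElem_append_right (by simp [hw1]; omega),
          List.getElem_append_right (by simp [hw1]; omega)]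
        simp only [List.length_map, hw1]
        have := word_std_le ((word σ).drop k) (i - k) (j - k) (by simp; omega) (by simp; omega)
          (by omega)
        have e1 : k + (i - k) = i := by omega
        have e2 : k + (j - k) = j := by omega
        simpa [suf, e1, e2] using this

theorem exists_isCut (σ : Permu) (hpos : 0 < σ.1) (h : ¬ IsAnticonnected σ) :
    ∃ k, 0 < k ∧ k < σ.1 ∧ IsCut σ k := by
  have h' : ¬ ∀ k, 0 < k → k < σ.1 → ¬ ∀ i : Fin σ.1, (i : ℕ) < k → (σ.2 i.rev : ℕ) < k :=
    fun hc => h ⟨hpos, hc⟩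
  push Not at h'
  obtain ⟨k, hk0, hk, hi⟩ := h'
  refine ⟨σ.1 - k, by omega, by omega, ?_⟩
  let A : Finset (Fin σ.1) := {i | (i : ℕ) < k}
  have hA : ∀ i, i ∈ A ↔ (i : ℕ) < k := by simp [A]
  let e : Equiv.Perm (Fin σ.1) := Fin.revPerm.trans σ.2
  have hmaps : A.map e.toEmbedding = A := by
    apply Finset.eq_of_subset_of_card_le
    · intro v hv
      simp only [Finset.mem_map_equiv] at hv
      have := hi _ ((hA _).1 hv)
      rw [hA]
      have h2 : σ.2 (e.symm v).rev = v := by simp [e]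
      rwa [h2] at this
    · simp
  intro i j hik hjk
  have hj : (σ.2 j : ℕ) < k := by
    have := hi j.rev (by rw [Fin.val_rev]; omega)
    simpa using this
  have hi' : ¬ (σ.2 i : ℕ) < k := by
    intro hc
    rw [← hA, ← hmaps, Finset.mem_map_equiv, hA] at hc
    have : e.symm (σ.2 i) = i.rev := by simp [e]
    rw [this, Fin.val_rev] at hc
    omega
  exact Fin.lt_def.2 (by omega)

/-- Every permutation has a decomposition into anticonnected components. -/
theorem exists_antiFactors (σ : Permu) :
    ∃ l : List Permu, (∀ τ ∈ l, IsAnticonnected τ) ∧ lconcatList l = σ := by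
  classical
  suffices H : ∀ n, ∀ σ : Permu, σ.1 = n →
      ∃ l : List Permu, (∀ τ ∈ l, IsAnticonnected τ) ∧ lconcatList l = σ from H _ σ rfl
  intro n
  induction n using Nat.strong_induction_on with
  | _ n ih =>
    intro σ hn
    by_cases h0 : σ.1 = 0
    · exact ⟨[], by simp, (fst_eq_zero h0).symm⟩
    have hex : ∃ k, 0 < k ∧ k ≤ σ.1 ∧ IsCut σ k :=
      ⟨σ.1, by omega, le_rfl, fun i j _ hj => absurd j.2 (by omega)⟩
    obtain ⟨hk0, hk, hcut⟩ := Nat.find_spec hex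
    have hmin := fun m => Nat.find_min hex (m := m)
    generalize Nat.find hex = k at hk0 hk hcut hmin
    have hpre : IsAnticonnected (pre σ k) := by
      by_contra hc
      obtain ⟨m, hm0, hm, hm'⟩ := exists_isCut _ (by rw [pre_fst]; omega) hc
      rw [pre_fst] at hm
      refine hmin m (by omega) ⟨hm0, by omega, fun i j hi hj => ?_⟩
      by_cases hjk : (j : ℕ) < k
      · have h1 := hm' ⟨i, by rw [pre_fst]; omega⟩ ⟨j, by rw [pre_fst]; omega⟩ hi hj
        have h2 := word_std_le ((word σ).take k) i j (by simp; omega) (by simp; omega) (by omega)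
        have h3 := not_congr h2
        simp only [word, List.getElem_ofFn, List.getElem_take, not_le] at h3
        exact Fin.lt_def.2 (h3.1 (Fin.lt_def.1 h1))
      · exact hcut i j (by omega) (by omega)
    obtain ⟨l, hl, hl'⟩ := ih (suf σ k).1 (by rw [suf_fst]; omega) (suf σ k) rfl
    refine ⟨pre σ k :: l, ?_, ?_⟩
    · intro τ hτ
      rcases List.mem_cons.1 hτ with rfl | hτ
      exacts [hpre, hl τ hτ]
    · have : lconcatList (pre σ k :: l) = lconcat (pre σ k) (lconcatList l) := rfl
      rw [this, hl', lconcat_eq σ k hk hcut]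

/-- The decomposition `σ = σ₁ ◁ ⋯ ◁ σᵣ` into anticonnected components, where `◁` is the
left-shifted concatenation. -/
def antiFactors (σ : Permu) : List Permu := (exists_antiFactors σ).choose

/-! ### The coproduct, primitive elements and the duality pairing -/

/-- The coproduct: `Δ F_σ` is the sum, over the factorizations `σ = u · v` of the word `σ`, of
`F_{std u} ⊗ F_{std v}`. -/
def comul : FQSym K →ₗ[K] FQSym K ⊗[K] FQSym K :=
  (fBasis K).constr K fun σ =>
    ∑ k ∈ Finset.range (σ.1 + 1), fBasis K (pre σ k) ⊗ₜ[K] fBasis K (suf σ k)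

variable {K} in
/-- Primitive elements: `Δ x = x ⊗ 1 + 1 ⊗ x`. -/
def IsPrimitive (x : FQSym K) : Prop := comul K x = x ⊗ₜ[K] 1 + 1 ⊗ₜ[K] x

open Classical in
/-- The bilinear pairing for which `(F_σ)` and `(G_σ)` are adjoint bases:
`⟨F_σ, G_τ⟩ = δ_{σ,τ}`. -/
def pairing : FQSym K →ₗ[K] FQSym K →ₗ[K] K :=
  (fBasis K).constr K fun σ => (gBasis K).constr K fun τ => if σ = τ then 1 else 0

/-! ### The families `S` and `M` -/

open Classical in
/-- The sum of the `G_τ` over the `τ ≤ σ` in the left weak order. -/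
def sumBelow (σ : Permu) : FQSym K :=
  ∑ τ : LeftWeak σ.1, if τ ≤ (show LeftWeak σ.1 from σ.2) then gBasis K ⟨σ.1, τ⟩ else 0

/-- The multiplicative family `S^σ = S^{σ₁} ⋯ S^{σᵣ}`, where `σ₁, …, σᵣ` are the anticonnected
components of `σ` and `S^σ` is the sum of the `G_τ`, `τ ≤ σ`, if `σ` is anticonnected. -/
def S (σ : Permu) : FQSym K := ((antiFactors σ).map (sumBelow K)).prod

/-- The free monomial functions: `M_σ` is the sum of the `μ(σ, τ) F_τ` over the `τ ≥ σ`, where `μ`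
is the Möbius function of the left weak order. -/
def M (σ : Permu) : FQSym K :=
  ∑ τ : LeftWeak σ.1 with (show LeftWeak σ.1 from σ.2) ≤ τ,
    IncidenceAlgebra.mu K (show LeftWeak σ.1 from σ.2) τ • fBasis K ⟨σ.1, τ⟩

end FQS

end

/-! The element `sumBelow σ`, the sum of all `G_τ` with `τ ≤ σ`, is multiplicative for `◁`: every
pair of positions across the cut of `σ ◁ τ` is already an inversion, so `γ ≤ σ ◁ τ` only constrains
the standardized prefix and suffix of `γ` (`below_of_isCut`, `sumBelow_lconcat`). Hence `S^σ` equals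
`sumBelow σ` for every `σ`, and its adjointness to `M` is Möbius inversion on weak order intervals
(`pairing_M_sumBelow`).

The coproduct is dual to the product, so `x` is primitive iff `⟨x, ·⟩` is a derivation relative to
the counit. Tested on the spanning family `sumBelow`, which is closed under products, this says that
`⟨x, S^σ⟩ = 0` whenever `σ` is not anticonnected (`isPrimitive_iff_sumBelow`). These pairings are
the coordinates of `x` on the basis `M`, so the primitives are exactly the span of the `M_σ` with
`σ` anticonnected.

Closure under the bracket is proved without establishing that the coproduct is an algebra morphism.
Pairing with `G_α G_β` is a sum over the shuffles of `α⁻¹` with the shifted `β⁻¹`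
(`pairing_gBasis_mul`), and multiplying elements deconcatenates words. Primitive elements vanish on
shuffles of nonempty words, so for primitive `x` and `y` only two terms of `⟨xy, G_α G_β⟩` survive;
their sum is symmetric in `x` and `y` (`IsPrimitive.shuffleSum_mul`) and cancels in the commutator.
-/

namespace FQS

/-! ### Shuffles of words -/

/-- The list of all shuffles of two words. -/
def shuffles {α : Type*} : List α → List α → List (List α)
  | [], v => [v]
  | a :: u, [] => [a :: u]
  | a :: u, b :: v =>
    (shuffles u (b :: v)).map (List.cons a) ++ (shuffles (a :: u) v).map (List.cons b)
  termination_by u v => u.length + v.length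

theorem shuffles_nil_left {α : Type*} (v : List α) : shuffles [] v = [v] := by
  rw [shuffles]

theorem shuffles_nil_right {α : Type*} (u : List α) : shuffles u [] = [u] := by
  cases u <;> rw [shuffles]

theorem shuffles_cons_cons {α : Type*} (a b : α) (u v : List α) : shuffles (a :: u) (b :: v) =
    (shuffles u (b :: v)).map (List.cons a) ++ (shuffles (a :: u) v).map (List.cons b) := by
  rw [shuffles]

theorem shuffles_map {α β : Type*} (f : α → β) (u v : List α) :
    shuffles (u.map f) (v.map f) = (shuffles u v).map (List.map f) := by
  induction u, v using shuffles.induct with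
  | case1 v => simp [shuffles_nil_left]
  | case2 a u => simp [shuffles_nil_right]
  | case3 a u b v ih1 ih2 =>
    simp only [List.map_cons] at ih1 ih2
    simp only [List.map_cons, shuffles_cons_cons, ih1, ih2, List.map_append, List.map_map]
    rfl

theorem perm_of_mem_shuffles {α : Type*} {u v w : List α} (hw : w ∈ shuffles u v) :
    w.Perm (u ++ v) := by
  induction u, v using shuffles.induct generalizing w with
  | case1 v => simp_all [shuffles_nil_left]
  | case2 a u => simp_all [shuffles_nil_right]
  | case3 a u b v ih1 ih2 =>
    rw [shuffles_cons_cons, List.mem_append, List.mem_map, List.mem_map] at hw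
    rcases hw with ⟨w, hw, rfl⟩ | ⟨w, hw, rfl⟩
    · exact (ih1 hw).cons a
    · exact ((ih2 hw).cons b).trans (List.perm_middle (l₁ := a :: u)).symm

/-- If `p` holds on `u` and fails on `v`, the shuffles of `u` and `v` are the words whose
subwords of letters with and without `p` are `u` and `v`. -/
theorem mem_shuffles_iff {α : Type*} (p : α → Bool) {u v : List α} (hu : ∀ a ∈ u, p a = true)
    (hv : ∀ a ∈ v, p a = false) (w : List α) :
    w ∈ shuffles u v ↔ w.filter p = u ∧ (w.filter fun a => !p a) = v := by
  have key : ∀ w : List α, w ∈ shuffles (w.filter p) (w.filter fun a => !p a) := by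
    intro w
    induction w with
    | nil => simp [shuffles_nil_left]
    | cons c w ih =>
      cases hc : p c
      · simp only [List.filter_cons, hc, Bool.not_false, if_true, Bool.false_eq_true, if_false]
        generalize w.filter p = u at ih
        cases u with
        | nil =>
          rw [shuffles_nil_left, List.mem_singleton] at ih ⊢
          rw [← ih]
        | cons a u =>
          rw [shuffles_cons_cons]
          exact List.mem_append_right _ (List.mem_map_of_mem ih)
      · simp only [List.filter_cons, hc, Bool.not_true, if_true, Bool.false_eq_true, if_false]
        generalize (w.filter fun a => !p a) = v at ih
        cases v with
        | nil =>
          rw [shuffles_nil_right, List.mem_singleton] at ih ⊢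
          rw [← ih]
        | cons a v =>
          rw [shuffles_cons_cons]
          exact List.mem_append_left _ (List.mem_map_of_mem ih)
  constructor
  · intro hw
    induction u, v using shuffles.induct generalizing w with
    | case1 v =>
      rw [shuffles_nil_left, List.mem_singleton] at hw
      subst hw
      simp_all
    | case2 a u =>
      rw [shuffles_nil_right, List.mem_singleton] at hw
      subst hw
      simp_all
    | case3 a u b v ih1 ih2 =>
      rw [shuffles_cons_cons, List.mem_append, List.mem_map, List.mem_map] at hw
      have ha := hu a (by simp)
      have hb := hv b (by simp)
      rcases hw with ⟨w, hw, rfl⟩ | ⟨w, hw, rfl⟩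
      · have := ih1 (fun c hc => hu c (List.mem_cons_of_mem _ hc)) hv w hw
        simp [ha, this.1, this.2]
      · have := ih2 hu (fun c hc => hv c (List.mem_cons_of_mem _ hc)) w hw
        simp [hb, this.1, this.2]
  · rintro ⟨rfl, rfl⟩
    exact key w

/-- With disjoint alphabets the first letter of a shuffle tells which word it came from, so the two
branches of the recursion cannot overlap. This lets `shuffleSum` be read as a sum over a `Finset`.
-/
theorem nodup_shuffles {α : Type*} {u v : List α} (h : ∀ a ∈ u, a ∉ v) :
    (shuffles u v).Nodup := by
  induction u, v using shuffles.induct with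
  | case1 v => simp [shuffles_nil_left]
  | case2 a u => simp [shuffles_nil_right]
  | case3 a u b v ih1 ih2 =>
    rw [shuffles_cons_cons]
    refine List.Nodup.append ((ih1 fun c hc => h c (List.mem_cons_of_mem _ hc)).map
      List.cons_injective) ((ih2 fun c hc hcv => h c hc (List.mem_cons_of_mem _ hcv)).map
      List.cons_injective) ?_
    intro w h1 h2
    simp only [List.mem_map] at h1 h2
    obtain ⟨w1, -, rfl⟩ := h1
    obtain ⟨w2, -, e⟩ := h2
    have : b = a := (List.cons.inj e).1
    exact h a (by simp) (by simp [this])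

section Deconcatenation

variable {α K : Type*} [AddCommMonoid K]

/-- The sum of a function over the shuffles of two words. -/
def shuffleSum (φ : List α → K) (u v : List α) : K := ((shuffles u v).map φ).sum

theorem shuffleSum_nil_left (φ : List α → K) (v : List α) : shuffleSum φ [] v = φ v := by
  simp [shuffleSum, shuffles_nil_left]

theorem shuffleSum_nil_right (φ : List α → K) (u : List α) : shuffleSum φ u [] = φ u := by
  simp [shuffleSum, shuffles_nil_right]

theorem shuffleSum_cons_cons (φ : List α → K) (a b : α) (u v : List α) :
    shuffleSum φ (a :: u) (b :: v) =
      shuffleSum (fun w => φ (a :: w)) u (b :: v) + shuffleSum (fun w => φ (b :: w)) (a :: u) v := by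
  simp [shuffleSum, shuffles_cons_cons, Function.comp_def]

theorem shuffleSum_add (φ ψ : List α → K) (u v : List α) :
    shuffleSum (fun w => φ w + ψ w) u v = shuffleSum φ u v + shuffleSum ψ u v := by
  simp [shuffleSum, List.sum_map_add]

/-- Summing over the deconcatenations of the shuffles of `u` and `v` amounts to deconcatenating
`u` and `v`, and shuffling the prefixes and the suffixes. -/
theorem shuffleSum_deconcatenation (F : List α → List α → K) (u v : List α) :
    shuffleSum (fun w => ∑ k ∈ Finset.range (w.length + 1), F (w.take k) (w.drop k)) u v =
      ∑ i ∈ Finset.range (u.length + 1), ∑ j ∈ Finset.range (v.length + 1),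
        shuffleSum (fun s => shuffleSum (fun t => F s t) (u.drop i) (v.drop j))
          (u.take i) (v.take j) := by
  induction u, v using shuffles.induct generalizing F with
  | case1 v => simp [shuffleSum_nil_left]
  | case2 a u => simp [shuffleSum_nil_right]
  | case3 a u b v ih1 ih2 =>
    -- The empty prefix is split off; every other deconcatenation of `c :: w` comes from one of `w`.
    have e : ∀ (F : List α → List α → K) (c : α) (w : List α),
        ∑ k ∈ Finset.range ((c :: w).length + 1), F ((c :: w).take k) ((c :: w).drop k) =
          F [] (c :: w) + ∑ k ∈ Finset.range (w.length + 1), F (c :: w.take k) (w.drop k) := by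
      intro F c w
      rw [List.length_cons, Finset.sum_range_succ', add_comm]
      simp
    rw [shuffleSum_cons_cons]
    simp only [e, shuffleSum_add]
    rw [ih1 (fun s t => F (a :: s) t), ih2 (fun s t => F (b :: s) t)]
    simp only [List.length_cons]
    -- Split at `i = 0` and `j = 0`. The term with both prefixes empty accounts for the two `F []`
    -- sums; a nonempty prefix shuffle starts with `a` or with `b`, which are the two induction
    -- hypotheses.
    have h1 := Finset.sum_range_succ' (fun i => ∑ j ∈ Finset.range (v.length + 1 + 1),
        shuffleSum (fun s => shuffleSum (fun t => F s t) ((a :: u).drop i) ((b :: v).drop j))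
          ((a :: u).take i) ((b :: v).take j)) (u.length + 1)
    have h2 := fun i => Finset.sum_range_succ' (fun j =>
        shuffleSum (fun s => shuffleSum (fun t => F s t) ((a :: u).drop i) ((b :: v).drop j))
          ((a :: u).take i) ((b :: v).take j)) (v.length + 1)
    rw [h1]
    simp only [h2]
    have h3 := fun i => Finset.sum_range_succ' (fun j =>
        shuffleSum (fun s => shuffleSum (fun t => F (a :: s) t) (u.drop i) ((b :: v).drop j))
          (u.take i) ((b :: v).take j)) (v.length + 1)
    have h4 := Finset.sum_range_succ' (fun i => ∑ j ∈ Finset.range (v.length + 1),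
        shuffleSum (fun s => shuffleSum (fun t => F (b :: s) t) ((a :: u).drop i) (v.drop j))
          ((a :: u).take i) (v.take j)) (u.length + 1)
    simp only [h3, h4, List.take_succ_cons, List.drop_succ_cons, List.take_zero, List.drop_zero,
      shuffleSum_nil_left, shuffleSum_nil_right, shuffleSum_cons_cons, Finset.sum_add_distrib]
    abel

end Deconcatenation

/-! ### Letters of a permutation by position -/

/-- The letter of `σ` at position `i` (and `0` outside of the word). -/
def val (σ : Permu) (i : ℕ) : ℕ := (word σ).getD i 0

theorem val_eq_getElem (σ : Permu) {i : ℕ} (hi : i < (word σ).length) :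
    val σ i = (word σ)[i] := by
  rw [val, List.getD_eq_getElem _ _ hi]

theorem val_fin (σ : Permu) (i : Fin σ.1) : val σ i = σ.2 i := by
  rw [val_eq_getElem σ (by simp)]
  simp [word]

theorem val_lt (σ : Permu) {i : ℕ} (hi : i < σ.1) : val σ i < σ.1 := by
  have := val_fin σ ⟨i, hi⟩
  simp only at this
  rw [this]
  exact (σ.2 ⟨i, hi⟩).2

theorem nodup_word (σ : Permu) : (word σ).Nodup := by
  rw [word, List.nodup_ofFn]
  exact fun i j h => σ.2.injective (Fin.ext h)

/-- Distinct letters are not needed here: `std` numbers equal letters from left to right, so a tie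
never creates a descent. -/
theorem val_std_lt_val_std (w : List ℕ) {i j : ℕ} (hi : i < w.length) (hj : j < w.length)
    (hij : i < j) : val (std w) j < val (std w) i ↔ w[j] < w[i] := by
  have hs : (std w).1 = w.length := rfl
  rw [val_eq_getElem _ (by rw [length_word]; omega), val_eq_getElem _ (by rw [length_word]; omega)]
  simpa only [not_le] using not_congr (word_std_le w i j hi hj hij)

theorem val_std_lt_iff {w : List ℕ} (hw : w.Nodup) {i j : ℕ} (hi : i < w.length)
    (hj : j < w.length) : val (std w) i < val (std w) j ↔ w[i] < w[j] := by
  have hs : (std w).1 = w.length := rfl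
  rcases lt_trichotomy i j with h | rfl | h
  · have h1 := word_std_le w i j hi hj h
    have h2 : w[i] ≠ w[j] := fun e => h.ne ((hw.getElem_inj_iff).1 e)
    have h3 : (word (std w))[i]'(by rw [length_word]; omega) ≠
        (word (std w))[j]'(by rw [length_word]; omega) :=
      fun e => h.ne (((nodup_word _).getElem_inj_iff).1 e)
    rw [val_eq_getElem _ (by rw [length_word]; omega), val_eq_getElem _ (by rw [length_word]; omega)]
    omega
  · simp
  · exact val_std_lt_val_std w hj hi h

theorem val_pre_lt_iff (σ : Permu) {k i j : ℕ} (hk : k ≤ σ.1) (hi : i < k) (hj : j < k) :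
    val (pre σ k) i < val (pre σ k) j ↔ val σ i < val σ j := by
  have hn : ((word σ).take k).Nodup := (nodup_word σ).sublist (List.take_sublist _ _)
  rw [pre, val_std_lt_iff hn (by simp; omega) (by simp; omega),
    val_eq_getElem σ (by simp; omega), val_eq_getElem σ (by simp; omega)]
  simp

theorem val_suf_lt_iff (σ : Permu) {k i j : ℕ} (hi : k + i < σ.1) (hj : k + j < σ.1) :
    val (suf σ k) i < val (suf σ k) j ↔ val σ (k + i) < val σ (k + j) := by
  have hn : ((word σ).drop k).Nodup := (nodup_word σ).sublist (List.drop_sublist _ _)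
  rw [suf, val_std_lt_iff hn (by simp; omega) (by simp; omega),
    val_eq_getElem σ (by simp; omega), val_eq_getElem σ (by simp; omega)]
  simp

theorem isCut_iff (σ : Permu) (k : ℕ) :
    IsCut σ k ↔ ∀ i j, i < k → k ≤ j → j < σ.1 → i < σ.1 → val σ j < val σ i := by
  constructor
  · intro h i j hi hj hjn hin
    have := h ⟨i, hin⟩ ⟨j, hjn⟩ hi hj
    rw [Fin.lt_def, ← val_fin, ← val_fin] at this
    exact this
  · intro h i j hi hj
    rw [Fin.lt_def, ← val_fin, ← val_fin]
    exact h i j hi hj j.2 i.2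

/-! ### Left-shifted concatenation -/

theorem lconcat_fst (σ τ : Permu) : (lconcat σ τ).1 = σ.1 + τ.1 := by simp [lconcat, std]

theorem std_map {w : List ℕ} {f : ℕ → ℕ} (hf : StrictMono f) : std (w.map f) = std w := by
  refine std_congr (by simp) fun i j hi hj _ => ?_
  simp [hf.le_iff_le]

theorem pre_lconcat (σ τ : Permu) : pre (lconcat σ τ) σ.1 = σ := by
  rw [pre, lconcat, std_take, List.take_left' (by simp),
    std_map (f := (· + τ.1)) (fun a b h => Nat.add_lt_add_right h _), std_word]

theorem suf_lconcat (σ τ : Permu) : suf (lconcat σ τ) σ.1 = τ := by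
  rw [suf, lconcat, std_drop, List.drop_left' (by simp), std_word]

theorem isCut_lconcat (σ τ : Permu) : IsCut (lconcat σ τ) σ.1 := by
  rw [isCut_iff]
  intro i j hi hj hjn _
  rw [lconcat_fst] at hjn
  rw [lconcat, val_std_lt_val_std _ (by simp; omega) (by simp; omega) (by omega),
    List.getElem_append_right (by simpa using hj), List.getElem_append_left (by simpa using hi)]
  have h := val_lt τ (i := j - σ.1) (by omega)
  rw [val_eq_getElem τ (by simp; omega)] at h
  simp only [List.length_map, length_word, List.getElem_map]
  omega

/-- By counting: a letter `v ≥ n - k` has fewer than `k` letters above it, yet a letter after the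
cut lies below all `k` letters before it. So the letters after the cut are `< n - k`, and they form
a prefix of the mirror image. -/
theorem not_isAnticonnected_of_isCut {σ : Permu} {k : ℕ} (h0 : 0 < k) (hk : k < σ.1)
    (h : IsCut σ k) : ¬ IsAnticonnected σ := by
  intro hc
  obtain ⟨n, σ⟩ := σ
  simp only at hk
  refine hc.2 (n - k) (by omega) (by change n - k < n; omega) ?_
  change ∀ i : Fin n, (i : ℕ) < n - k → (σ i.rev : ℕ) < n - k
  intro i hi
  by_contra hlt
  have hsub : (Finset.univ.filter fun j : Fin n => (j : ℕ) < k).image σ ⊆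
      (Finset.univ.filter fun v : Fin n => (σ i.rev : ℕ) < v) := by
    intro v hv
    simp only [Finset.mem_image, Finset.mem_filter, Finset.mem_univ, true_and] at hv ⊢
    obtain ⟨j, hj, rfl⟩ := hv
    exact h j i.rev hj (by rw [Fin.val_rev]; change k ≤ n - (i + 1); omega)
  have hcard := Finset.card_le_card hsub
  rw [Finset.card_image_of_injective _ σ.injective] at hcard
  have e1 : (Finset.univ.filter fun j : Fin n => (j : ℕ) < k).card = k := by
    rw [Fin.card_filter_val_lt]; omega
  have e2 : (Finset.univ.filter fun v : Fin n => (σ i.rev : ℕ) < v).card = n - 1 - σ i.rev := by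
    have := Fin.card_Ioi (σ i.rev)
    rw [← this]
    congr 1
    ext v
    simp only [Finset.mem_filter, Finset.mem_univ, true_and, Finset.mem_Ioi]
    exact Iff.rfl
  have := (σ i.rev).2
  omega

/-! ### The left weak order on permutations of all sizes -/

/-- `γ ≤ σ` in the left weak order (for permutations of the same size). -/
def Below (γ σ : Permu) : Prop :=
  γ.1 = σ.1 ∧ ∀ i j, i < j → j < γ.1 → val γ j < val γ i → val σ j < val σ i

theorem below_mk {n : ℕ} (σ τ : LeftWeak n) : Below ⟨n, σ⟩ ⟨n, τ⟩ ↔ σ ≤ τ := by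
  constructor
  · rintro ⟨-, h⟩ i j hij hlt
    have h1 := h i j hij j.2
    have e1 := fun a => val_fin ⟨n, σ⟩ a
    have e2 := fun a => val_fin ⟨n, τ⟩ a
    simp only at e1 e2
    rw [e1, e1, e2, e2] at h1
    exact h1 hlt
  · intro h
    refine ⟨rfl, fun i j hij hj hlt => ?_⟩
    have hj' : j < n := hj
    have e1 := fun a => val_fin ⟨n, σ⟩ a
    have e2 := fun a => val_fin ⟨n, τ⟩ a
    simp only at e1 e2
    have h1 := h ⟨i, by omega⟩ ⟨j, hj⟩ hij
    have a1 := e1 ⟨i, by omega⟩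
    have a2 := e1 ⟨j, hj⟩
    have a3 := e2 ⟨i, by omega⟩
    have a4 := e2 ⟨j, hj⟩
    simp only at a1 a2 a3 a4
    rw [a1, a2] at hlt
    rw [a3, a4]
    exact h1 hlt

/-- A pair of positions straddling the cut is an inversion of `ρ`, so it puts no condition on `γ`;
all other pairs lie within the prefix or within the suffix. -/
theorem below_of_isCut {γ ρ : Permu} {k : ℕ} (hk : k ≤ ρ.1) (h : IsCut ρ k) (hγ : γ.1 = ρ.1) :
    Below γ ρ ↔ Below (pre γ k) (pre ρ k) ∧ Below (suf γ k) (suf ρ k) := by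
  rw [isCut_iff] at h
  constructor
  · rintro ⟨-, H⟩
    refine ⟨⟨by simp [pre_fst, hγ], fun i j hij hj => ?_⟩,
      ⟨by simp [suf_fst, hγ], fun i j hij hj => ?_⟩⟩
    · rw [pre_fst] at hj
      rw [val_pre_lt_iff γ (by omega) (by omega) (by omega),
        val_pre_lt_iff ρ (by omega) (by omega) (by omega)]
      exact H i j hij (by omega)
    · rw [suf_fst] at hj
      rw [val_suf_lt_iff γ (by omega) (by omega), val_suf_lt_iff ρ (by omega) (by omega)]
      exact H _ _ (by omega) (by omega)
  · rintro ⟨⟨-, H1⟩, -, H2⟩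
    refine ⟨hγ, fun i j hij hj hlt => ?_⟩
    rcases lt_or_ge j k with hjk | hjk
    · have := H1 i j hij (by rw [pre_fst]; omega)
      rw [val_pre_lt_iff γ (by omega) (by omega) (by omega),
        val_pre_lt_iff ρ (by omega) (by omega) (by omega)] at this
      exact this hlt
    · rcases lt_or_ge i k with hik | hik
      · exact h i j hik hjk (by omega) (by omega)
      · obtain ⟨i, rfl⟩ := Nat.exists_eq_add_of_le hik
        obtain ⟨j, rfl⟩ := Nat.exists_eq_add_of_le hjk
        have := H2 i j (by omega) (by rw [suf_fst]; omega)
        rw [val_suf_lt_iff γ (by omega) (by omega), val_suf_lt_iff ρ (by omega) (by omega)] at this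
        exact this hlt

/-! ### Inverse permutations and subwords -/

theorem inv_injective : Function.Injective inv := invEquiv.injective

theorem mem_word (σ : Permu) (a : ℕ) : a ∈ word σ ↔ a < σ.1 := by
  rw [word, List.mem_ofFn]
  constructor
  · rintro ⟨i, rfl⟩
    exact (σ.2 i).2
  · intro h
    exact ⟨σ.2⁻¹ ⟨a, h⟩, by simp⟩

/-- The word of `ρ⁻¹` lists the positions of `ρ` by increasing letter. With `eq_of_pairwise_val`,
this identifies words of inverses from their sets of letters alone. -/
theorem pairwise_word_inv (ρ : Permu) :
    (word (inv ρ)).Pairwise fun a b => val ρ a < val ρ b := by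
  obtain ⟨n, ρ⟩ := ρ
  have e := fun i => val_fin ⟨n, ρ⟩ i
  simp only at e
  have : word (inv ⟨n, ρ⟩) = List.ofFn fun i : Fin n => ((ρ⁻¹ i : Fin n) : ℕ) := rfl
  rw [this, List.pairwise_ofFn]
  intro i j hij
  rw [e, e]
  simpa using hij

theorem eq_of_pairwise_val (γ : Permu) {l l' : List ℕ}
    (h : l.Pairwise fun a b => val γ a < val γ b) (h' : l'.Pairwise fun a b => val γ a < val γ b)
    (hm : ∀ a, a ∈ l ↔ a ∈ l') : l = l' := by
  have hn : ∀ {l : List ℕ}, (l.Pairwise fun a b => val γ a < val γ b) → l.Nodup :=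
    fun h => h.imp fun hab e => by simp [e] at hab
  exact List.Perm.eq_of_pairwise (fun a b _ _ h1 h2 => absurd h1 h2.not_gt) h h'
    ((List.perm_ext_iff_of_nodup (hn h) (hn h')).2 hm)

/-- Positions of `γ` are letters of `γ⁻¹`, so cutting `γ` at position `k` separates the small
letters of `γ⁻¹` from the large ones. -/
theorem filter_lt_word_inv (γ : Permu) {k : ℕ} (hk : k ≤ γ.1) :
    (word (inv γ)).filter (fun a => decide (a < k)) = word (inv (pre γ k)) := by
  have hs : ∀ ρ, (inv ρ).1 = ρ.1 := fun _ => rfl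
  refine eq_of_pairwise_val γ ((pairwise_word_inv γ).filter _)
    ((pairwise_word_inv (pre γ k)).imp_of_mem fun {a b} ha hb h => ?_) fun a => ?_
  · rw [mem_word, hs, pre_fst] at ha hb
    exact (val_pre_lt_iff γ hk (by omega) (by omega)).1 h
  · rw [List.mem_filter, mem_word, mem_word, hs, hs, pre_fst, decide_eq_true_eq]
    omega

theorem filter_ge_word_inv (γ : Permu) {k : ℕ} (hk : k ≤ γ.1) :
    (word (inv γ)).filter (fun a => !decide (a < k)) = (word (inv (suf γ k))).map (k + ·) := by
  have hs : ∀ ρ, (inv ρ).1 = ρ.1 := fun _ => rfl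
  refine eq_of_pairwise_val γ ((pairwise_word_inv γ).filter _)
    (List.pairwise_map.2 ((pairwise_word_inv (suf γ k)).imp_of_mem fun {a b} ha hb h => ?_))
    fun a => ?_
  · rw [mem_word, hs, suf_fst] at ha hb
    exact (val_suf_lt_iff γ (by omega) (by omega)).1 h
  · simp only [List.mem_filter, List.mem_map, mem_word, hs, suf_fst, Bool.not_eq_true',
      decide_eq_false_iff_not, not_lt]
    constructor
    · exact fun h => ⟨a - k, by omega, by omega⟩
    · rintro ⟨b, hb, rfl⟩
      omega

theorem exists_word_eq {n : ℕ} {w : List ℕ} (hl : w.length = n) (hw : w.Nodup)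
    (h : ∀ a ∈ w, a < n) : ∃ δ : Equiv.Perm (Fin n), word ⟨n, δ⟩ = w := by
  subst hl
  let f : Fin w.length → Fin w.length := fun i => ⟨w.get i, h _ (List.get_mem w i)⟩
  have hf : Function.Injective f := fun i j e =>
    (List.nodup_iff_injective_get.1 hw) (Fin.mk.inj e)
  refine ⟨Equiv.ofBijective f (Finite.injective_iff_bijective.1 hf), ?_⟩
  exact List.ofFn_get w

variable (K : Type*) [Field K]

/-! ### Multiplicativity of the sums over lower intervals -/

open Classical in
theorem coeff_sumBelow (γ σ : Permu) :
    coeff K γ (sumBelow K σ) = if Below γ σ then 1 else 0 := by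
  rw [sumBelow, map_sum]
  simp only [apply_ite (coeff K γ), coeff_gBasis, map_zero]
  by_cases h : γ.1 = σ.1
  · obtain ⟨n, γ⟩ := γ
    obtain ⟨m, σ⟩ := σ
    obtain rfl : n = m := h
    rw [Finset.sum_eq_single (show LeftWeak n from γ)]
    · have : (Below ⟨n, γ⟩ ⟨n, σ⟩) ↔ (show LeftWeak n from γ) ≤ (show LeftWeak n from σ) :=
        below_mk (show LeftWeak n from γ) (show LeftWeak n from σ)
      simp only [this]
      simp
    · intro b _ hb
      have : (⟨n, b⟩ : Permu) ≠ ⟨n, γ⟩ := fun e => hb (eq_of_heq (Sigma.mk.inj e).2)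
      simp [this]
    · exact fun hc => absurd (Finset.mem_univ _) hc
  · rw [if_neg (fun hc => h hc.1)]
    refine Finset.sum_eq_zero fun b _ => ?_
    have : (⟨σ.1, b⟩ : Permu) ≠ γ := fun e => h (by rw [← e])
    simp [this]

/-- In the coefficient of the product only the splitting at `k = σ.1` can contribute, for reasons of
size, and there `below_of_isCut` applies. -/
theorem sumBelow_lconcat (σ τ : Permu) :
    sumBelow K (lconcat σ τ) = sumBelow K σ * sumBelow K τ := by
  classical
  refine ext_coeff K fun γ => ?_
  simp only [coeff_mul, coeff_sumBelow]
  by_cases h : γ.1 = σ.1 + τ.1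
  · have h1 := below_of_isCut (γ := γ) (ρ := lconcat σ τ) (k := σ.1)
      (by rw [lconcat_fst]; omega) (isCut_lconcat σ τ) (by rw [lconcat_fst, h])
    rw [pre_lconcat, suf_lconcat] at h1
    rw [Finset.sum_eq_single σ.1]
    · simp only [h1]
      split_ifs <;> simp_all
    · intro k hk hne
      simp only [Finset.mem_range] at hk
      rw [if_neg (fun hc : Below (pre γ k) σ => hne (by have := hc.1; rw [pre_fst] at this; omega)),
        zero_mul]
    · intro hc; simp only [Finset.mem_range] at hc; omega
  · rw [if_neg (fun hc => h (by rw [hc.1, lconcat_fst]))]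
    symm
    refine Finset.sum_eq_zero fun k hk => ?_
    simp only [Finset.mem_range] at hk
    by_contra hc
    have h1 : Below (pre γ k) σ := by by_contra e; simp [e] at hc
    have h2 : Below (suf γ k) τ := by by_contra e; simp [e] at hc
    have h3 := h1.1
    have h4 := h2.1
    rw [pre_fst] at h3
    rw [suf_fst] at h4
    omega

theorem sumBelow_emptyPermu : sumBelow K emptyPermu = 1 := by
  classical
  refine ext_coeff K fun γ => ?_
  rw [coeff_sumBelow, coeff_one]
  refine if_congr ⟨fun h => h.1, fun h => ?_⟩ rfl rfl
  rw [fst_eq_zero h]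
  exact ⟨rfl, fun i j _ hj => absurd hj (Nat.not_lt_zero _)⟩

/-- The multiplicative family is `S^σ = ∑ G_τ`, `τ ≤ σ`, for all permutations `σ`. -/
theorem S_eq_sumBelow (σ : Permu) : S K σ = sumBelow K σ := by
  have key : ∀ l : List Permu, (l.map (sumBelow K)).prod = sumBelow K (lconcatList l) := by
    intro l
    induction l with
    | nil => exact (sumBelow_emptyPermu K).symm
    | cons a l ih =>
      rw [List.map_cons, List.prod_cons, ih, ← sumBelow_lconcat]
      rfl
  rw [S, key]
  exact congrArg _ (exists_antiFactors σ).choose_spec.2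

/-! ### Duality -/

open Classical in
theorem pairing_fBasis (σ : Permu) (y : FQSym K) :
    pairing K (fBasis K σ) y = coeff K σ y := by
  have : pairing K (fBasis K σ) = coeff K σ := by
    refine (gBasis K).ext fun τ => ?_
    rw [coeff_gBasis, pairing, Module.Basis.constr_basis, Module.Basis.constr_basis]
    exact if_congr eq_comm rfl rfl
  rw [this]

theorem M_mk {n : ℕ} (σ : LeftWeak n) : M K ⟨n, σ⟩ =
    ∑ τ ∈ Finset.univ.filter fun τ : LeftWeak n => σ ≤ τ,
      IncidenceAlgebra.mu K σ τ • fBasis K ⟨n, τ⟩ := rfl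

-- Pairing `F_ρ` with `sumBelow τ` tests `ρ ≤ τ`, leaving the sum of `μ(σ, ρ)` over the interval
-- `[σ, τ]`, which is `δ` by the defining property of `μ`. Different sizes are orthogonal.
open Classical in
theorem pairing_M_sumBelow (σ τ : Permu) :
    pairing K (M K σ) (sumBelow K τ) = if σ = τ then 1 else 0 := by
  by_cases h : σ.1 = τ.1
  · obtain ⟨n, σ⟩ := σ
    obtain ⟨m, τ⟩ := τ
    obtain rfl : n = m := h
    have H : ∀ σ τ : LeftWeak n, pairing K (M K ⟨n, σ⟩) (sumBelow K ⟨n, τ⟩) =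
        if (⟨n, σ⟩ : Permu) = ⟨n, τ⟩ then 1 else 0 := by
      intro σ τ
      have e : ((⟨n, σ⟩ : Permu) = ⟨n, τ⟩) ↔ σ = τ :=
        ⟨fun e => eq_of_heq (Sigma.mk.inj e).2, fun e => congrArg (Sigma.mk n) e⟩
      have key := IncidenceAlgebra.sum_Icc_mu_right (𝕜 := K) σ τ
      rw [M_mk, map_sum, LinearMap.sum_apply]
      simp only [map_smul, LinearMap.smul_apply, pairing_fBasis, coeff_sumBelow, smul_eq_mul,
        below_mk, e, mul_ite, mul_one, mul_zero]
      rw [← Finset.sum_filter, Finset.filter_filter]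
      refine Eq.trans (Finset.sum_congr ?_ fun _ _ => rfl) (key.trans (if_congr Iff.rfl rfl rfl))
      ext ρ
      simp
    exact H σ τ
  · rw [if_neg (fun hc => h (by rw [hc])), M, map_sum, LinearMap.sum_apply]
    refine Finset.sum_eq_zero fun ρ _ => ?_
    rw [map_smul, LinearMap.smul_apply, pairing_fBasis, coeff_sumBelow,
      if_neg (fun hc => h hc.1), smul_zero]

/-- Unitriangularity over the `G_σ`: each `G_σ` is recovered by induction from the smaller ones. -/
theorem span_sumBelow : Submodule.span K (Set.range (sumBelow K)) = ⊤ := by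
  classical
  rw [eq_top_iff, ← (gBasis K).span_eq, Submodule.span_le]
  rintro _ ⟨⟨n, σ⟩, rfl⟩
  have H : ∀ σ : LeftWeak n, gBasis K ⟨n, σ⟩ ∈ Submodule.span K (Set.range (sumBelow K)) := by
    intro σ
    induction σ using WellFoundedLT.induction with
    | _ σ ih =>
      have h1 : sumBelow K ⟨n, σ⟩ ∈ Submodule.span K (Set.range (sumBelow K)) :=
        Submodule.subset_span ⟨_, rfl⟩
      have h2 : sumBelow K ⟨n, σ⟩ = gBasis K ⟨n, σ⟩ +
          ∑ τ ∈ Finset.univ.erase σ, if τ ≤ σ then gBasis K ⟨n, τ⟩ else 0 := by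
        rw [sumBelow, ← Finset.add_sum_erase _ _ (Finset.mem_univ σ)]
        congr 1
        exact if_pos le_rfl
      rw [← sub_eq_iff_eq_add] at h2
      rw [← h2]
      refine Submodule.sub_mem _ h1 (Submodule.sum_mem _ fun τ hτ => ?_)
      split_ifs with hle
      · exact ih τ (lt_of_le_of_ne hle (Finset.ne_of_mem_erase hτ))
      · exact Submodule.zero_mem _
  exact H σ

/-- Unitriangularity over the `F_σ`, since `μ(σ, σ) = 1`; the induction now descends from the larger
permutations. -/
theorem span_M : Submodule.span K (Set.range (M K)) = ⊤ := by
  classical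
  rw [eq_top_iff, ← (fBasis K).span_eq, Submodule.span_le]
  rintro _ ⟨⟨n, σ⟩, rfl⟩
  have H : ∀ σ : LeftWeak n, fBasis K ⟨n, σ⟩ ∈ Submodule.span K (Set.range (M K)) := by
    intro σ
    induction σ using WellFoundedGT.induction with
    | _ σ ih =>
      have h1 : M K ⟨n, σ⟩ ∈ Submodule.span K (Set.range (M K)) :=
        Submodule.subset_span ⟨_, rfl⟩
      have h2 : M K ⟨n, σ⟩ = fBasis K ⟨n, σ⟩ +
          ∑ τ ∈ (Finset.univ.filter fun τ : LeftWeak n => σ ≤ τ).erase σ,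
            IncidenceAlgebra.mu K σ τ • fBasis K ⟨n, τ⟩ := by
        have hm : σ ∈ Finset.univ.filter fun τ : LeftWeak n => σ ≤ τ := by simp
        rw [M_mk, ← Finset.add_sum_erase _ _ hm, IncidenceAlgebra.mu_self, one_smul]
      rw [← sub_eq_iff_eq_add] at h2
      rw [← h2]
      refine Submodule.sub_mem _ h1 (Submodule.sum_mem _ fun τ hτ => ?_)
      have h4 := Finset.mem_of_mem_erase hτ
      simp only [Finset.mem_filter, Finset.mem_univ, true_and] at h4
      exact Submodule.smul_mem _ _ (ih τ (lt_of_le_of_ne h4 (Finset.ne_of_mem_erase hτ).symm))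
  exact H σ

theorem linearIndependent_M : LinearIndependent K (M K) := by
  classical
  rw [linearIndependent_iff]
  intro l hl
  ext σ
  have := congrArg (fun x => pairing K x (sumBelow K σ)) hl
  simpa [Finsupp.linearCombination_apply, Finsupp.sum, pairing_M_sumBelow] using this

/-! ### Primitive elements by duality -/

theorem fBasis_repr (x : FQSym K) (α : Permu) :
    (fBasis K).repr x α = pairing K x (gBasis K α) := by
  classical
  have : (fBasis K).coord α = (pairing K).flip (gBasis K α) := by
    refine (fBasis K).ext fun σ => ?_
    rw [LinearMap.flip_apply, pairing_fBasis, coeff_gBasis, Module.Basis.coord_apply,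
      Module.Basis.repr_self, Finsupp.single_apply]
    exact if_congr eq_comm rfl rfl
  exact congrArg (fun L : FQSym K →ₗ[K] K => L x) this

/-- The coproduct is dual to the product. -/
theorem repr_comul (x : FQSym K) (α β : Permu) :
    ((fBasis K).tensorProduct (fBasis K)).repr (comul K x) (α, β) =
      pairing K x (gBasis K α * gBasis K β) := by
  classical
  have : ((fBasis K).tensorProduct (fBasis K)).coord (α, β) ∘ₗ comul K =
      (pairing K).flip (gBasis K α * gBasis K β) := by
    refine (fBasis K).ext fun σ => ?_
    rw [LinearMap.flip_apply, pairing_fBasis, coeff_mul, LinearMap.comp_apply, comul,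
      Module.Basis.constr_basis, map_sum]
    -- Both sides run over the same splittings of `σ` into standardized prefix and suffix, and agree
    -- term by term.
    refine Finset.sum_congr rfl fun k _ => ?_
    rw [Module.Basis.coord_apply, Module.Basis.tensorProduct_repr_tmul_apply, coeff_gBasis,
      coeff_gBasis, Module.Basis.repr_self, Module.Basis.repr_self, Finsupp.single_apply,
      Finsupp.single_apply, smul_eq_mul, mul_comm]
    simp only [eq_comm]
  exact congrArg (fun L : FQSym K →ₗ[K] K => L x) this

theorem one_eq_fBasis : (1 : FQSym K) = fBasis K emptyPermu := by
  rw [fBasis_apply, one_def]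
  exact congrArg _ (fst_eq_zero rfl)

/-- Writing the coordinates of `1` through the counit `coeff emptyPermu` makes the primitivity
condition bilinear in the two `G`'s, hence transferable to other spanning families. -/
theorem fBasis_repr_one (α : Permu) :
    (fBasis K).repr (1 : FQSym K) α = coeff K emptyPermu (gBasis K α) := by
  classical
  rw [one_eq_fBasis, Module.Basis.repr_self, coeff_gBasis, Finsupp.single_apply]
  exact if_congr eq_comm rfl rfl

theorem isPrimitive_iff_gBasis (x : FQSym K) : IsPrimitive x ↔ ∀ α β : Permu,
    pairing K x (gBasis K α * gBasis K β) =
      pairing K x (gBasis K α) * coeff K emptyPermu (gBasis K β) +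
        coeff K emptyPermu (gBasis K α) * pairing K x (gBasis K β) := by
  rw [IsPrimitive, ← ((fBasis K).tensorProduct (fBasis K)).repr.injective.eq_iff, Finsupp.ext_iff,
    Prod.forall]
  refine forall₂_congr fun α β => ?_
  rw [repr_comul, map_add, Finsupp.add_apply, Module.Basis.tensorProduct_repr_tmul_apply,
    Module.Basis.tensorProduct_repr_tmul_apply, fBasis_repr_one, fBasis_repr_one, fBasis_repr,
    fBasis_repr, smul_eq_mul, smul_eq_mul, mul_comm (pairing K x (gBasis K β)),
    mul_comm (coeff K emptyPermu (gBasis K β))]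

/-- The counit property and the derivation property characterizing primitive elements may be
checked on any spanning family. -/
theorem isPrimitive_iff_of_span {ι : Type*} {s : ι → FQSym K}
    (hs : Submodule.span K (Set.range s) = ⊤) (x : FQSym K) : IsPrimitive x ↔ ∀ i j,
    pairing K x (s i * s j) =
      pairing K x (s i) * coeff K emptyPermu (s j) +
        coeff K emptyPermu (s i) * pairing K x (s j) := by
  let P : FQSym K →ₗ[K] K := pairing K x
  let A : FQSym K →ₗ[K] FQSym K →ₗ[K] K := (mulLin K).compr₂ P
  let B : FQSym K →ₗ[K] FQSym K →ₗ[K] K :=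
    (LinearMap.mul K K).compl₁₂ P (coeff K emptyPermu) +
      (LinearMap.mul K K).compl₁₂ (coeff K emptyPermu) P
  have hg : IsPrimitive x ↔ A = B := by
    rw [isPrimitive_iff_gBasis]
    exact ⟨fun h => (gBasis K).ext fun α => (gBasis K).ext fun β => h α β,
      fun h α β => congrArg (fun L : FQSym K →ₗ[K] FQSym K →ₗ[K] K => L _ _) h⟩
  rw [hg]
  constructor
  · exact fun h i j => congrArg (fun L : FQSym K →ₗ[K] FQSym K →ₗ[K] K => L _ _) h
  · intro h
    exact LinearMap.ext_on_range hs fun i => LinearMap.ext_on_range hs fun j => h i j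

theorem coeff_emptyPermu_sumBelow (σ : Permu) :
    coeff K emptyPermu (sumBelow K σ) = if σ.1 = 0 then 1 else 0 := by
  classical
  rw [coeff_sumBelow]
  refine if_congr ⟨fun h => h.1.symm, fun h => ?_⟩ rfl rfl
  rw [fst_eq_zero h]
  exact ⟨rfl, fun i j _ hj => absurd hj (Nat.not_lt_zero _)⟩

/-- The counit kills `sumBelow` in positive size, so for nonempty `σ`, `τ` the derivation rule says
that `x` is orthogonal to `sumBelow (lconcat σ τ)`. Such concatenations are exactly the nonempty
permutations that are not anticonnected; the empty one is handled by the rule for `1 * 1`. -/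
theorem isPrimitive_iff_sumBelow (x : FQSym K) : IsPrimitive x ↔ ∀ σ : Permu,
    ¬ IsAnticonnected σ → pairing K x (sumBelow K σ) = 0 := by
  rw [isPrimitive_iff_of_span K (span_sumBelow K)]
  have he : emptyPermu.1 = 0 := rfl
  simp only [← sumBelow_lconcat, coeff_emptyPermu_sumBelow]
  constructor
  · intro h σ hσ
    by_cases h0 : σ.1 = 0
    · have := h emptyPermu emptyPermu
      rw [fst_eq_zero h0]
      have e : lconcat emptyPermu emptyPermu = emptyPermu := fst_eq_zero (lconcat_fst _ _)
      rw [e, if_pos he, mul_one, one_mul] at this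
      exact left_eq_add.1 this
    · obtain ⟨k, hk0, hk, hc⟩ := exists_isCut σ (by omega) hσ
      have := h (pre σ k) (suf σ k)
      rwa [lconcat_eq σ k hk.le hc, if_neg (by rw [suf_fst]; omega),
        if_neg (by rw [pre_fst]; omega), mul_zero, zero_mul, add_zero] at this
  · intro h σ τ
    have h1 : pairing K x (sumBelow K emptyPermu) = 0 := h _ fun hc => lt_irrefl 0 hc.1
    by_cases hσ : σ.1 = 0
    · rw [fst_eq_zero hσ, h1, zero_mul, zero_add]
      have e : lconcat emptyPermu τ = τ := by
        have h2 := lconcat_eq τ 0 (Nat.zero_le _) (fun _ _ hc => absurd hc (Nat.not_lt_zero _))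
        rwa [suf_zero, fst_eq_zero (σ := pre τ 0) (by rw [pre_fst]; omega)] at h2
      rw [e, if_pos he, one_mul]
    by_cases hτ : τ.1 = 0
    · rw [fst_eq_zero hτ, h1, mul_zero, add_zero]
      have e : lconcat σ emptyPermu = σ := by
        have h2 := lconcat_eq σ σ.1 le_rfl (fun _ j _ hc => absurd j.2 (by omega))
        rwa [pre_self, fst_eq_zero (σ := suf σ σ.1) (by rw [suf_fst]; omega)] at h2
      rw [e, if_pos he, mul_one]
    rw [if_neg hσ, if_neg hτ, mul_zero, zero_mul, add_zero]
    exact h _ (not_isAnticonnected_of_isCut (k := σ.1) (by omega) (by rw [lconcat_fst]; omega)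
      (isCut_lconcat σ τ))

/-! ### The free monomial basis and the primitive subspace -/

/-- The basis `(M_σ)`. -/
noncomputable def mBasis : Module.Basis Permu K (FQSym K) :=
  Module.Basis.mk (linearIndependent_M K) (span_M K).ge

theorem mBasis_repr (x : FQSym K) (σ : Permu) :
    (mBasis K).repr x σ = pairing K x (sumBelow K σ) := by
  classical
  have : (mBasis K).coord σ = (pairing K).flip (sumBelow K σ) := by
    refine (mBasis K).ext fun τ => ?_
    rw [Module.Basis.coord_apply, Module.Basis.repr_self, LinearMap.flip_apply, mBasis,
      Module.Basis.mk_apply, pairing_M_sumBelow, Finsupp.single_apply]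
  exact congrArg (fun L : FQSym K →ₗ[K] K => L x) this

theorem isPrimitive_M {σ : Permu} (hσ : IsAnticonnected σ) : IsPrimitive (M K σ) := by
  classical
  rw [isPrimitive_iff_sumBelow]
  intro τ hτ
  rw [pairing_M_sumBelow, if_neg]
  rintro rfl
  exact hτ hσ

/-- The submodule of primitive elements. -/
def primitives : Submodule K (FQSym K) where
  carrier := {x | IsPrimitive x}
  add_mem' {x y} hx hy := by
    simp only [Set.mem_ofPred_eq, isPrimitive_iff_sumBelow] at *
    intro σ hσ
    rw [map_add, LinearMap.add_apply, hx σ hσ, hy σ hσ, add_zero]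
  zero_mem' := by
    simp only [Set.mem_ofPred_eq, isPrimitive_iff_sumBelow]
    intro σ _
    rw [map_zero, LinearMap.zero_apply]
  smul_mem' c x hx := by
    simp only [Set.mem_ofPred_eq, isPrimitive_iff_sumBelow] at *
    intro σ hσ
    rw [map_smul, LinearMap.smul_apply, hx σ hσ, smul_zero]

/-- The basis `(M_σ)`, `σ` anticonnected, of the space of primitive elements. -/
noncomputable def primitiveBasis :
    Module.Basis {σ : Permu // IsAnticonnected σ} K (primitives K) :=
  Module.Basis.mk (v := fun σ => ⟨M K σ.1, isPrimitive_M K σ.2⟩)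
    (LinearIndependent.of_comp (primitives K).subtype
      ((linearIndependent_M K).comp _ Subtype.val_injective)) (by
    rintro ⟨x, hx⟩ -
    -- Spanning is checked in the ambient space, where `x` can be expanded on `mBasis`; its
    -- coordinates off the anticonnected permutations vanish.
    suffices H : x ∈ (Submodule.span K (Set.range fun σ : {σ : Permu // IsAnticonnected σ} =>
        (⟨M K σ.1, isPrimitive_M K σ.2⟩ : primitives K))).map (primitives K).subtype by
      obtain ⟨y, hy, rfl⟩ := H
      exact hy
    rw [Submodule.map_span, ← Set.range_comp]
    rw [← (mBasis K).linearCombination_repr x, Finsupp.linearCombination_apply]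
    refine Submodule.sum_mem _ fun σ hσ => ?_
    rw [Finsupp.mem_support_iff, mBasis_repr] at hσ
    have ha : IsAnticonnected σ := by
      by_contra hc
      exact hσ ((isPrimitive_iff_sumBelow K x).1 hx σ hc)
    refine Submodule.smul_mem _ _ (Submodule.subset_span ⟨⟨σ, ha⟩, ?_⟩)
    rw [mBasis, Module.Basis.mk_apply]
    rfl)

theorem primitiveBasis_apply (σ : {σ : Permu // IsAnticonnected σ}) :
    (primitiveBasis K σ : FQSym K) = M K σ.1 := by
  rw [primitiveBasis, Module.Basis.mk_apply]

/-! ### The coproduct and shuffles -/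

theorem pairing_gBasis (x : FQSym K) (γ : Permu) :
    pairing K x (gBasis K γ) = coeff K (inv γ) x := by
  classical
  have : (pairing K).flip (gBasis K γ) = coeff K (inv γ) := by
    refine (fBasis K).ext fun σ => ?_
    rw [LinearMap.flip_apply, pairing_fBasis, fBasis_apply, coeff_gBasis, coeff_gBasis]
    exact if_congr (eq_comm.trans inv_injective.eq_iff.symm) rfl rfl
  exact congrArg (fun L : FQSym K →ₗ[K] K => L x) this

/-- The coefficient of `x` on the standardization of a word. -/
noncomputable def wordCoeff (x : FQSym K) (w : List ℕ) : K := coeff K (std w) x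

/-- Standardizing a word before cutting it does not change the standardized pieces. The product thus
deconcatenates raw words, as `shuffleSum_deconcatenation` requires. -/
theorem wordCoeff_mul (x y : FQSym K) (w : List ℕ) : wordCoeff K (x * y) w =
    ∑ k ∈ Finset.range (w.length + 1), wordCoeff K x (w.take k) * wordCoeff K y (w.drop k) := by
  rw [wordCoeff, coeff_mul]
  refine Finset.sum_congr rfl fun k _ => ?_
  rw [pre, suf, std_take, std_drop, wordCoeff, wordCoeff]

/-- The coproduct as a sum over shifted shuffles. -/
theorem pairing_gBasis_mul (x : FQSym K) (α β : Permu) :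
    pairing K x (gBasis K α * gBasis K β) =
      shuffleSum (wordCoeff K x) (word (inv α)) ((word (inv β)).map (α.1 + ·)) := by
  classical
  have hs : ∀ ρ, (inv ρ).1 = ρ.1 := fun _ => rfl
  have hp : ∀ a ∈ word (inv α), decide (a < α.1) = true := by
    intro a ha
    rw [mem_word] at ha
    exact decide_eq_true ha
  have hq : ∀ a ∈ (word (inv β)).map (α.1 + ·), decide (a < α.1) = false := by
    intro a ha
    obtain ⟨b, -, rfl⟩ := List.mem_map.1 ha
    simp
  have hd : ∀ a ∈ word (inv α), a ∉ (word (inv β)).map (α.1 + ·) := by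
    intro a ha ha'
    have h1 := hp a ha
    rw [hq a ha'] at h1
    exact Bool.false_ne_true h1
  rw [shuffleSum, ← List.sum_toFinset _ (nodup_shuffles hd), gBasis_mul, conv, map_sum]
  simp only [apply_ite (pairing K x), map_zero, pairing_gBasis]
  rw [← Finset.sum_filter]
  -- The letters of `γ⁻¹` below `α.1` must spell `α⁻¹` and the others the shifted `β⁻¹`: this is
  -- membership in the shuffle.
  have hc : ∀ γ : Equiv.Perm (Fin (α.1 + β.1)),
      (pre ⟨_, γ⟩ α.1 = α ∧ suf ⟨_, γ⟩ α.1 = β) ↔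
        word (inv ⟨_, γ⟩) ∈ shuffles (word (inv α)) ((word (inv β)).map (α.1 + ·)) := by
    intro γ
    rw [mem_shuffles_iff (fun a => decide (a < α.1)) hp hq,
      filter_lt_word_inv _ (Nat.le_add_right _ _), filter_ge_word_inv _ (Nat.le_add_right _ _),
      word_injective.eq_iff, inv_injective.eq_iff,
      (List.map_injective_iff.2 (add_right_injective α.1)).eq_iff,
      word_injective.eq_iff, inv_injective.eq_iff]
  refine Finset.sum_bij (fun γ _ => word (inv ⟨_, γ⟩)) ?_ ?_ ?_ ?_
  · intro γ hγ
    rw [Finset.mem_filter] at hγ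
    exact List.mem_toFinset.2 ((hc γ).1 hγ.2)
  · intro γ _ γ' _ h
    exact eq_of_heq (Sigma.mk.inj (inv_injective (word_injective h))).2
  · intro w hw
    have hw' := List.mem_toFinset.1 hw
    have hperm := perm_of_mem_shuffles hw'
    obtain ⟨δ, hδ⟩ := exists_word_eq (n := α.1 + β.1) (w := w)
      (by rw [hperm.length_eq]; simp [hs])
      (hperm.nodup_iff.2 ((nodup_word _).append
        ((nodup_word _).map (add_right_injective α.1)) hd))
      (fun a ha => by
        rw [hperm.mem_iff, List.mem_append, mem_word, List.mem_map] at ha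
        rcases ha with ha | ⟨b, hb, rfl⟩
        · rw [hs] at ha; omega
        · rw [mem_word, hs] at hb; omega)
    have e : word (inv ⟨_, δ⁻¹⟩) = w := by
      rw [← hδ, ← inv_inv' ⟨_, δ⟩]
      rfl
    refine ⟨δ⁻¹, ?_, e⟩
    rw [Finset.mem_filter, hc, e]
    exact ⟨Finset.mem_univ _, hw'⟩
  · intro γ _
    rw [wordCoeff, std_word]

/-- When one factor is `1`, the derivation rule only says that the constant term of `x` vanishes;
for two nonempty factors its right side is zero. -/
theorem isPrimitive_iff_of_pos (x : FQSym K) : IsPrimitive x ↔ coeff K emptyPermu x = 0 ∧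
    ∀ α β : Permu, 0 < α.1 → 0 < β.1 → pairing K x (gBasis K α * gBasis K β) = 0 := by
  classical
  have h0 : pairing K x (gBasis K emptyPermu) = coeff K emptyPermu x := by
    rw [pairing_gBasis, fst_eq_zero (σ := inv emptyPermu) rfl]
  have h1 : coeff K emptyPermu (gBasis K emptyPermu) = 1 := by rw [coeff_gBasis, if_pos rfl]
  have h2 : ∀ α : Permu, 0 < α.1 → coeff K emptyPermu (gBasis K α) = 0 := by
    intro α hα
    rw [coeff_gBasis, if_neg]
    rintro rfl
    exact lt_irrefl 0 hα
  rw [isPrimitive_iff_gBasis]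
  constructor
  · intro h
    constructor
    · have := h emptyPermu emptyPermu
      rw [← one_def, one_mul, one_def, h0, h1, mul_one, one_mul] at this
      exact left_eq_add.1 this
    · intro α β hα hβ
      rw [h, h2 α hα, h2 β hβ, mul_zero, zero_mul, add_zero]
  · rintro ⟨hx, h⟩ α β
    rcases Nat.eq_zero_or_pos α.1 with hα | hα
    · rw [fst_eq_zero hα, h0, hx, h1, zero_mul, zero_add, one_mul, ← one_def, one_mul]
    rcases Nat.eq_zero_or_pos β.1 with hβ | hβ
    · rw [fst_eq_zero hβ, h0, hx, h1, mul_zero, add_zero, mul_one, ← one_def, mul_one]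
    rw [h α β hα hβ, h2 α hα, h2 β hβ, mul_zero, zero_mul, add_zero]

/-! ### The commutator of primitive elements -/

theorem map_val_std_idxOf {u : List ℕ} (hu : u.Nodup) :
    (u.map fun a => val (std u) (u.idxOf a)) = word (std u) := by
  have hs : (std u).1 = u.length := rfl
  refine List.ext_getElem (by rw [List.length_map, length_word, hs]) fun i h1 h2 => ?_
  rw [List.getElem_map, hu.idxOf_getElem, val_eq_getElem]

/-- Two words, the letters of the first being smaller than those of the second, can be
standardized simultaneously. -/
theorem exists_standardizing {u v : List ℕ} (hu : u.Nodup) (hv : v.Nodup)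
    (h : ∀ a ∈ u, ∀ b ∈ v, a < b) : ∃ c : ℕ → ℕ, u.map c = word (std u) ∧
      v.map c = (word (std v)).map (u.length + ·) ∧ StrictMonoOn c {a | a ∈ u ++ v} := by
  classical
  have hs : ∀ w, (std w).1 = w.length := fun _ => rfl
  -- Each letter goes to its rank in its own word, shifted by the length of `u` for letters of `v`;
  -- values outside both words are irrelevant.
  let c : ℕ → ℕ := fun a =>
    if a ∈ u then val (std u) (u.idxOf a) else u.length + val (std v) (v.idxOf a)
  have cu : ∀ a ∈ u, c a = val (std u) (u.idxOf a) := fun a ha => if_pos ha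
  have cv : ∀ a ∈ v, c a = u.length + val (std v) (v.idxOf a) :=
    fun a ha => if_neg fun hc => lt_irrefl _ (h a hc a ha)
  have hmono : ∀ {w : List ℕ}, w.Nodup → ∀ a ∈ w, ∀ b ∈ w, a < b →
      val (std w) (w.idxOf a) < val (std w) (w.idxOf b) := by
    intro w hw a ha b hb hab
    rw [val_std_lt_iff hw (List.idxOf_lt_length_of_mem ha) (List.idxOf_lt_length_of_mem hb),
      List.getElem_idxOf, List.getElem_idxOf]
    exact hab
  refine ⟨c, ?_, ?_, ?_⟩
  · rw [← map_val_std_idxOf hu]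
    exact List.map_congr_left cu
  · rw [← map_val_std_idxOf hv, List.map_map]
    exact List.map_congr_left cv
  · intro a ha b hb hab
    rcases List.mem_append.1 ha with ha | ha <;> rcases List.mem_append.1 hb with hb | hb
    · rw [cu a ha, cu b hb]
      exact hmono hu a ha b hb hab
    · rw [cu a ha, cv b hb]
      have := val_lt (std u) (i := u.idxOf a) (by rw [hs]; exact List.idxOf_lt_length_of_mem ha)
      rw [hs] at this
      omega
    · exact absurd hab (h b hb a ha).not_gt
    · rw [cv a ha, cv b hb]
      exact Nat.add_lt_add_left (hmono hv a ha b hb hab) _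

theorem std_map_of_strictMonoOn {w : List ℕ} {c : ℕ → ℕ} (hc : StrictMonoOn c {a | a ∈ w}) :
    std (w.map c) = std w := by
  refine std_congr (by simp) fun i j hi hj _ => ?_
  rw [List.length_map] at hi hj
  rw [List.getElem_map, List.getElem_map]
  exact hc.le_iff_le (List.getElem_mem hi) (List.getElem_mem hj)

variable {K}

/-- A primitive element is orthogonal to the shuffles of two nonempty words. -/
theorem IsPrimitive.shuffleSum_eq_zero {x : FQSym K} (hx : IsPrimitive x) {u v : List ℕ}
    (hu : u.Nodup) (hv : v.Nodup) (h : ∀ a ∈ u, ∀ b ∈ v, a < b) (hu0 : 0 < u.length)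
    (hv0 : 0 < v.length) : shuffleSum (wordCoeff K x) u v = 0 := by
  obtain ⟨c, h1, h2, hc⟩ := exists_standardizing hu hv h
  -- Inverses are taken because the pairing with `G_α G_β` shuffles the words of `α⁻¹` and `β⁻¹`.
  have key := pairing_gBasis_mul K x (inv (std u)) (inv (std v))
  rw [inv_inv', inv_inv'] at key
  have e : (inv (std u)).1 = u.length := rfl
  rw [e, ← h1, ← h2, shuffleSum, shuffles_map, List.map_map,
    ((isPrimitive_iff_of_pos K x).1 hx).2 _ _ hu0 hv0] at key
  rw [shuffleSum, key]
  refine congrArg List.sum (List.map_congr_left fun w hw => ?_)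
  have hp := perm_of_mem_shuffles hw
  rw [Function.comp_apply, wordCoeff, wordCoeff,
    std_map_of_strictMonoOn (hc.mono fun a ha => hp.mem_iff.1 ha)]

theorem shuffleSum_mul {α : Type*} (f g : List α → K) (u v u' v' : List α) :
    shuffleSum (fun s => shuffleSum (fun t => f s * g t) u' v') u v =
      shuffleSum f u v * shuffleSum g u' v' := by
  simp only [shuffleSum, List.sum_map_mul_left, List.sum_map_mul_right]

/-- After deconcatenation, `x` kills every term with two nonempty prefixes and `y` every term with
two nonempty suffixes. What survives is `x` on all of one word times `y` on all of the other, an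
expression symmetric in `x` and `y`. -/
theorem IsPrimitive.shuffleSum_mul {x y : FQSym K} (hx : IsPrimitive x) (hy : IsPrimitive y)
    {u v : List ℕ} (hu : u.Nodup) (hv : v.Nodup) (h : ∀ a ∈ u, ∀ b ∈ v, a < b)
    (hu0 : 0 < u.length) (hv0 : 0 < v.length) : shuffleSum (wordCoeff K (x * y)) u v =
      wordCoeff K x u * wordCoeff K y v + wordCoeff K x v * wordCoeff K y u := by
  have hF := shuffleSum_deconcatenation (fun s t => wordCoeff K x s * wordCoeff K y t) u v
  have e : wordCoeff K (x * y) = fun w => ∑ k ∈ Finset.range (w.length + 1),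
      wordCoeff K x (w.take k) * wordCoeff K y (w.drop k) := funext (wordCoeff_mul K x y)
  rw [e, hF]
  have hT : ∀ i ∈ Finset.range (u.length + 1), ∀ j ∈ Finset.range (v.length + 1),
      shuffleSum (fun s => shuffleSum (fun t => wordCoeff K x s * wordCoeff K y t)
        (u.drop i) (v.drop j)) (u.take i) (v.take j) =
      (if i = u.length then if j = 0 then wordCoeff K x u * wordCoeff K y v else 0 else 0) +
      (if i = 0 then if j = v.length then wordCoeff K x v * wordCoeff K y u else 0 else 0) := by
    intro i hi j hj
    rw [Finset.mem_range] at hi hj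
    rw [FQS.shuffleSum_mul]
    by_cases h1 : 0 < i ∧ 0 < j
    · rw [hx.shuffleSum_eq_zero (hu.sublist (List.take_sublist _ _))
        (hv.sublist (List.take_sublist _ _))
        (fun a ha b hb => h a (List.mem_of_mem_take ha) b (List.mem_of_mem_take hb))
        (by rw [List.length_take]; omega) (by rw [List.length_take]; omega), zero_mul,
        if_neg (by omega : i ≠ 0), if_neg (by omega : j ≠ 0), ite_self, add_zero]
    by_cases h2 : i < u.length ∧ j < v.length
    · rw [hy.shuffleSum_eq_zero (hu.sublist (List.drop_sublist _ _))
        (hv.sublist (List.drop_sublist _ _))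
        (fun a ha b hb => h a (List.mem_of_mem_drop ha) b (List.mem_of_mem_drop hb))
        (by rw [List.length_drop]; omega) (by rw [List.length_drop]; omega), mul_zero,
        if_neg (by omega : i ≠ u.length), if_neg (by omega : j ≠ v.length), ite_self, add_zero]
    -- Nonemptiness of `u` and `v` excludes `i = 0 = u.length` and `j = 0 = v.length`.
    have h3 : (i = u.length ∧ j = 0) ∨ (i = 0 ∧ j = v.length) := by omega
    rcases h3 with ⟨rfl, rfl⟩ | ⟨rfl, rfl⟩
    · rw [if_pos rfl, if_pos rfl, if_neg (by omega), add_zero, List.take_length, List.drop_length,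
        List.take_zero, List.drop_zero, shuffleSum_nil_left, shuffleSum_nil_right]
    · rw [if_pos rfl, if_pos rfl, if_neg (by omega), zero_add, List.take_length, List.drop_length,
        List.take_zero, List.drop_zero, shuffleSum_nil_left, shuffleSum_nil_right]
  rw [Finset.sum_congr rfl fun i hi => Finset.sum_congr rfl (hT i hi)]
  simp [Finset.sum_add_distrib]

/-- The symmetric expression of `IsPrimitive.shuffleSum_mul` is the same for `x * y` and `y * x`;
constant terms cancel because they multiply in `K`. -/
theorem IsPrimitive.commutator {x y : FQSym K} (hx : IsPrimitive x) (hy : IsPrimitive y) :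
    IsPrimitive (x * y - y * x) := by
  rw [isPrimitive_iff_of_pos]
  constructor
  · have h0 : emptyPermu.1 = 0 := rfl
    rw [map_sub, coeff_mul, coeff_mul, h0, Finset.sum_range_one, Finset.sum_range_one,
      fst_eq_zero (σ := pre emptyPermu 0) (by rw [pre_fst]; rfl),
      fst_eq_zero (σ := suf emptyPermu 0) (by rw [suf_fst]; rfl), mul_comm, sub_self]
  · intro α β hα hβ
    have hd : ∀ a ∈ word (inv α), ∀ b ∈ (word (inv β)).map (α.1 + ·), a < b := by
      intro a ha b hb
      rw [mem_word] at ha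
      obtain ⟨b, -, rfl⟩ := List.mem_map.1 hb
      exact Nat.lt_add_right b ha
    have h1 := nodup_word (inv α)
    have h2 := (nodup_word (inv β)).map (add_right_injective α.1)
    have h3 : 0 < (word (inv α)).length := by rw [length_word]; exact hα
    have h4 : 0 < ((word (inv β)).map (α.1 + ·)).length := by
      rw [List.length_map, length_word]; exact hβ
    rw [map_sub, LinearMap.sub_apply, pairing_gBasis_mul, pairing_gBasis_mul,
      hx.shuffleSum_mul hy h1 h2 hd h3 h4, hy.shuffleSum_mul hx h1 h2 hd h3 h4]
    ring

variable (K)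

/-- The Lie algebra of primitive elements. -/
noncomputable def primitiveLie : LieSubalgebra K (FQSym K) where
  __ := primitives K
  lie_mem' {_ _} hx hy := IsPrimitive.commutator hx hy

end FQS

theorem mainTheorem6 (K : Type*) [Field K] [CharZero K] :
    (∀ σ τ : FQS.Permu, FQS.pairing K (FQS.M K σ) (FQS.S K τ) = open Classical in
      if σ = τ then 1 else 0) ∧
    ∃ L : LieSubalgebra K (FQS.FQSym K),
      (∀ x : FQS.FQSym K, x ∈ L ↔ FQS.IsPrimitive x) ∧
      ∃ b : Module.Basis {σ : FQS.Permu // FQS.IsAnticonnected σ} K L,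
        ∀ σ : {σ : FQS.Permu // FQS.IsAnticonnected σ}, (b σ : FQS.FQSym K) = FQS.M K σ := by
  refine ⟨fun σ τ => ?_, FQS.primitiveLie K, fun x => Iff.rfl, FQS.primitiveBasis K,
    FQS.primitiveBasis_apply K⟩
  rw [FQS.S_eq_sumBelow, FQS.pairing_M_sumBelow]
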